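/- Let $\psi(s)=s/\sqrt{1+s^2}$, $f(u)=u-u^3$, $L>0$, $M\in\mathbb R$. For $\lambda>0$ consider classical solutions $u\in C^2((0,L))\cap C^1([0,L])$ of $$(\psi(u_x))_x+\lambda f(u)-\frac{\lambda}{L}\int_0^L f(u(x))\,dx=0 \text{ on } (0,L),\qquad u_x(0)=u_x(L)=0,\qquad \frac1L\int_0^L u\,dx=M,$$ which has the trivial solution $u\equiv M$ for every $\lambda$. Call $\lambda_0>0$ a bifurcation value if every neighbourhood of $(\lambda_0,M)$ in $\mathbb R\times C^2$ contains a pair $(\lambda,u)$ with $u$ a solution for the parameter $\lambda$, $u\not\equiv M$. For $|M|<1/\sqrt3$ and $k=1,2,\dots$ put $$\lambda_k=\frac{k^2\pi^2}{L^2(1-3M^2)}.$$ Say that the $k$-th bifurcation from $u\equiv M$ is a supercritical (subcritical) pitchfork if, for some $\delta>0$, the solutions $(\lambda,u)$ near $(\lambda_k,M)$ in $\mathbb R\times C^2$ are the trivial ones together with those on a single curve of solutions $$s\mapsto\bigl(\Lambda(s),\ M+s(\cos(k\pi x/L)+z(s)(x))\bigr),\qquad |s|<\delta,$$ where $\Lambda$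 is smooth, $\Lambda(0)=\lambda_k$, $z$ is continuous with values in $C^2$, $z(0)=0$, $z(s)$ is $L^2(0,L)$-orthogonal to $\cos(k\pi x/L)$, $\Lambda'(0)=0$, and $\Lambda''(0)>0$ (respectively $\Lambda''(0)<0$). Then: (a) If $|M|<1/\sqrt3$, the bifurcation values in $(0,\infty)$ are exactly $\lambda_1<\lambda_2<\cdots$. (b) If $0\le|M|<1/\sqrt5$ and $k\ge1$, the $k$-th bifurcation from $u\equiv M$ is a supercritical pitchfork if $L>L^*$ and a subcritical pitchfork if $L<L^*$, where $$L^*=\frac{k\pi}{\sqrt2}\,\frac{1-3M^2}{\sqrt{1-5M^2}}.$$ (c) If $1/\sqrt5<|M|<1/\sqrt3$, then for every $L>0$ and every $k\ge1$ the $k$-th bifurcation from $u\equiv M$ is a subcritical pitchfork. (d) If $|M|\ge1/\sqrt3$, then for every $L>0$ there is no bifurcation from $u\equiv M$: no $\lambda_0>0$ is a bifurcation value. -/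

import Mathlib

open Real Set Filter Topology
open scoped ContDiff

namespace MassConstrained

/-- The mean-curvature flux `ψ(s) = s / √(1 + s²)`. -/
noncomputable def psi (s : ℝ) : ℝ := s / √(1 + s ^ 2)

/-- The bistable nonlinearity `f = -W'`, where `W(u) = u⁴/4 - u²/2`. -/
def f (u : ℝ) : ℝ := u - u ^ 3

/-- Classical solutions, of class `C²((0,L)) ∩ C¹([0,L])`, of the stationary mass-constrained
problem `(ψ(u_x))_x + λ f(u) - (λ/L) ∫₀ᴸ f(u) = 0` on `(0,L)`, `u_x = 0` at `x = 0, L`,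
`(1/L) ∫₀ᴸ u = M`. Only the values of `u` on `[0,L]` matter. -/
structure IsClassicalSolution (L M lam : ℝ) (u : ℝ → ℝ) : Prop where
  contDiffOn_Ioo : ContDiffOn ℝ 2 u (Ioo 0 L)
  contDiffOn_Icc : ContDiffOn ℝ 1 u (Icc 0 L)
  equation : ∀ x ∈ Ioo 0 L,
    deriv (fun y => psi (deriv u y)) x + lam * f (u x)
      - lam / L * ∫ y in (0 : ℝ)..L, f (u y) = 0
  neumann_left : derivWithin u (Icc 0 L) 0 = 0
  neumann_right : derivWithin u (Icc 0 L) L = 0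
  mass : 1 / L * ∫ x in (0 : ℝ)..L, u x = M

/-- `u` and `w` are `ε`-close in the `C²` sense on `(0,L)`. -/
def C2Close (L ε : ℝ) (u w : ℝ → ℝ) : Prop :=
  ∀ x ∈ Ioo 0 L, |u x - w x| < ε ∧ |deriv u x - deriv w x| < ε ∧
    |deriv (deriv u) x - deriv (deriv w) x| < ε

/-- `(λ₀, u ≡ M)` is a bifurcation point: every neighbourhood of it, in `ℝ × C²`, contains a
pair `(λ, u)` where `u` is a solution other than the constant `M`. -/
def IsBifurcationPoint (L M lam₀ : ℝ) : Prop :=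
  ∀ ε > 0, ∃ (lam : ℝ) (u : ℝ → ℝ), |lam - lam₀| < ε ∧ IsClassicalSolution L M lam u ∧
    C2Close L ε u (fun _ => M) ∧ ∃ x ∈ Icc 0 L, u x ≠ M

/-- The `k`-th bifurcation value `λ_k = k²π² / (L² f'(M))`, with `f'(M) = 1 - 3M²`. -/
noncomputable def bifurcationValue (L M : ℝ) (k : ℕ) : ℝ :=
  (k : ℝ) ^ 2 * π ^ 2 / (L ^ 2 * (1 - 3 * M ^ 2))

/-- The point of parameter `s` on a branch through the constant solution `M`, tangent at
`s = 0` to the eigenfunction `cos (kπx/L)`. -/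
noncomputable def branch (L M : ℝ) (k : ℕ) (z : ℝ → ℝ → ℝ) (s : ℝ) : ℝ → ℝ :=
  fun x => M + s * (cos (k * π * x / L) + z s x)

/-- Near `(λ_k, M)` in `ℝ × C²`, the solution set is the trivial branch `u ≡ M` together with
one curve `s ↦ (Λ(s), M + s (cos (kπx/L) + z(s)))`, `|s| < δ`, where `Λ` is smooth, `z` is
continuous in `C²`, `z(0) = 0`, and `z(s)` is `L²`-orthogonal to `cos (kπx/L)`. -/
structure IsLocalBranch (L M : ℝ) (k : ℕ) (δ : ℝ) (Lam : ℝ → ℝ) (z : ℝ → ℝ → ℝ) : Prop where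
  pos : 0 < δ
  smooth : ContDiffOn ℝ ∞ Lam (Ioo (-δ) δ)
  lam_zero : Lam 0 = bifurcationValue L M k
  z_zero : ∀ x ∈ Icc 0 L, z 0 x = 0
  z_continuous : ∀ s₀ ∈ Ioo (-δ) δ, ∀ η > 0, ∀ᶠ s in 𝓝 s₀, C2Close L η (z s) (z s₀)
  z_orthogonal : ∀ s ∈ Ioo (-δ) δ, ∫ x in (0 : ℝ)..L, z s x * cos (k * π * x / L) = 0
  solution : ∀ s ∈ Ioo (-δ) δ, IsClassicalSolution L M (Lam s) (branch L M k z s)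
  complete : ∃ ε > 0, ∀ (lam : ℝ) (u : ℝ → ℝ), |lam - bifurcationValue L M k| < ε →
    IsClassicalSolution L M lam u → C2Close L ε u (fun _ => M) →
    (∀ x ∈ Icc 0 L, u x = M) ∨
      ∃ s ∈ Ioo (-δ) δ, s ≠ 0 ∧ lam = Lam s ∧ EqOn u (branch L M k z s) (Icc 0 L)

/-- The `k`-th bifurcation from `u ≡ M` is a supercritical pitchfork: the bifurcating branch
satisfies `Λ'(0) = 0` and `Λ''(0) > 0`. -/
def IsSupercriticalPitchfork (L M : ℝ) (k : ℕ) : Prop :=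
  ∃ (δ : ℝ) (Lam : ℝ → ℝ) (z : ℝ → ℝ → ℝ), IsLocalBranch L M k δ Lam z ∧
    deriv Lam 0 = 0 ∧ 0 < deriv (deriv Lam) 0

/-- The `k`-th bifurcation from `u ≡ M` is a subcritical pitchfork: the bifurcating branch
satisfies `Λ'(0) = 0` and `Λ''(0) < 0`. -/
def IsSubcriticalPitchfork (L M : ℝ) (k : ℕ) : Prop :=
  ∃ (δ : ℝ) (Lam : ℝ → ℝ) (z : ℝ → ℝ → ℝ), IsLocalBranch L M k δ Lam z ∧
    deriv Lam 0 = 0 ∧ deriv (deriv Lam) 0 < 0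

/-- The critical length `L* = (kπ/√2) (1 - 3M²) / √(1 - 5M²)`. -/
noncomputable def criticalLength (M : ℝ) (k : ℕ) : ℝ :=
  k * π / √2 * ((1 - 3 * M ^ 2) / √(1 - 5 * M ^ 2))

end MassConstrained

/-!
A solution of the differential equation conserves `1 / √(1 + u_x²) - λ F(u) + c u`, where `F' = f`
and `c` is the nonlocal term. Hence `u_x² = P(u)⁻² - 1` with `P` a quartic polynomial, and
`P = 1` at two values `m ± ρ` between which a small nonconstant solution oscillates. Writing
`u = m + ρ cos θ` removes the turning points: `dx/dθ` becomes `(1 - q) / √(λ R (1 - q / 2))`,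
smooth in `(λ, m, ρ, cos θ)` through `ρ = 0`, where `R` is twice the second divided difference of
`F` at `m - ρ, m + ρ, u`, and `q = λ ρ² sin² θ R / 2`. So the boundary value problem near the
constant `M` is equivalent to two scalar equations in `(λ, m, ρ)`: the interval is swept while
`θ` runs from `0` to `kπ`, and the mean of `u` is `M`. This equivalence is
`isClassicalSolution_profile` in one direction and `solution_near_constant` in the other; the
latter finds the second turning value from `u 0` and the average of `f(u)` and concludes by
uniqueness for the initial value problem.

Bifurcation values. As `ρ → 0` the speed of the angle tends to `√(λ₀ (1 - 3M²))`, so the interval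
length is a limit of multiples of `π / √(λ₀ (1 - 3M²))`, hence is one
(`exists_bifurcationValue_eq`).

Branch. The map `(λ, m, ρ) ↦ (length, mass defect, cosine coefficient)` is smooth, with injective
derivative at `(λ_k, M, 0)`; the inverse function theorem gives the branch parametrized by its
cosine coefficient `s`, and the local uniqueness (`exists_branch`). The exact expansion
`slowness_expansion` shows that the length and the mass defect have no term of first order in
`ρ`, and yields `(λ - λ_k) / s² → curvature M λ_k` (`tendsto_branch_parameter`). This determines
`Λ'(0) = 0` and `Λ''(0)`, whose sign is that of
`(1 - 5M²) / (1 - 3M²)² - (kπ/L)² / 2`.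

If `3M² ≥ 1`, then `(f(u) - f(M)) (u - M)` is at most a small multiple of `(u - M)²`. Testing the
equation with `u - M` and a Poincaré inequality force `u = M` (`not_isBifurcationPoint`).
-/

namespace MassConstrained

/-! ### Parametric integrals and the second derivative at a point -/

theorem hasFDerivAt_parametric_integral {E G : Type} [NormedAddCommGroup E] [NormedSpace ℝ E]
    [ProperSpace E] [NormedAddCommGroup G] [NormedSpace ℝ G]
    {F : E × ℝ → G} (hF : ContDiff ℝ 1 F) (a b : ℝ) (p : E) :
    HasFDerivAt (fun q => ∫ t in a..b, F (q, t))
      (∫ t in a..b, (fderiv ℝ F (p, t)).comp (ContinuousLinearMap.inl ℝ E ℝ)) p := by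
  have hcont : Continuous fun z : E × ℝ =>
      (fderiv ℝ F z).comp (ContinuousLinearMap.inl ℝ E ℝ) :=
    (hF.continuous_fderiv one_ne_zero).clm_comp continuous_const
  obtain ⟨C, hC⟩ := (((isCompact_closedBall p 1).prod
    (isCompact_uIcc (a := a) (b := b))).bddAbove_image hcont.norm.continuousOn)
  refine (intervalIntegral.hasFDerivAt_integral_of_dominated_of_fderiv_le
    (F' := fun q t => (fderiv ℝ F (q, t)).comp (ContinuousLinearMap.inl ℝ E ℝ))
    (bound := fun _ => C) (Metric.ball_mem_nhds p one_pos) ?_ ?_ ?_ ?_ ?_ ?_)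
  · exact Eventually.of_forall fun q =>
      (hF.continuous.comp (Continuous.prodMk_right q)).aestronglyMeasurable
  · exact (hF.continuous.comp (Continuous.prodMk_right p)).intervalIntegrable _ _
  · exact (hcont.comp (Continuous.prodMk_right p)).aestronglyMeasurable
  · refine Eventually.of_forall fun t ht q hq => hC ?_
    exact ⟨(q, t), ⟨Metric.ball_subset_closedBall hq, uIoc_subset_uIcc ht⟩, rfl⟩
  · exact intervalIntegrable_const
  · refine Eventually.of_forall fun t _ q _ => ?_
    have h1 : HasFDerivAt F (fderiv ℝ F (q, t)) (q, t) :=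
      (hF.differentiable one_ne_zero _).hasFDerivAt
    exact HasFDerivAt.comp (g := F) (f := fun q => (q, t)) q h1 (hasFDerivAt_prodMk_left q t)

theorem contDiff_nat_parametric_integral {E : Type} [NormedAddCommGroup E] [NormedSpace ℝ E]
    [ProperSpace E] (n : ℕ) : ∀ {G : Type} [NormedAddCommGroup G] [NormedSpace ℝ G]
    {F : E × ℝ → G} (_ : ContDiff ℝ ∞ F) (a b : ℝ),
    ContDiff ℝ n (fun q => ∫ t in a..b, F (q, t)) := by
  induction n with
  | zero =>
    intro G _ _ F hF a b
    refine contDiff_zero.2 (Differentiable.continuous (𝕜 := ℝ) fun p => ?_)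
    exact (hasFDerivAt_parametric_integral (hF.of_le (by exact_mod_cast le_top)) a b p).differentiableAt
  | succ n ih =>
    intro G _ _ F hF a b
    have h := hasFDerivAt_parametric_integral (hF.of_le (by exact_mod_cast le_top)) a b
    rw [Nat.cast_succ]
    refine contDiff_succ_iff_fderiv.2 ⟨fun p => (h p).differentiableAt,
      fun hω => absurd hω (by simp), ?_⟩
    rw [show fderiv ℝ (fun q => ∫ t in a..b, F (q, t)) = _ from funext fun p => (h p).fderiv]
    exact ih (F := fun z => (fderiv ℝ F z).comp (ContinuousLinearMap.inl ℝ E ℝ))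
      ((hF.fderiv_right (m := ∞) (by simp)).clm_comp contDiff_const) a b

theorem contDiff_parametric_integral {E G : Type} [NormedAddCommGroup E] [NormedSpace ℝ E]
    [ProperSpace E] [NormedAddCommGroup G] [NormedSpace ℝ G]
    {F : E × ℝ → G} (hF : ContDiff ℝ ∞ F) (a b : ℝ) :
    ContDiff ℝ ∞ (fun q => ∫ t in a..b, F (q, t)) :=
  contDiff_infty.2 fun n => contDiff_nat_parametric_integral n hF a b

/-- The limit of the second-order quotient determines the first two derivatives: the first must
vanish, and by L'Hôpital's rule the limit is half the second. -/
theorem second_derivative_of_tendsto_quotient {g : ℝ → ℝ} {l : ℝ} (hg : ContDiffAt ℝ 2 g 0)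
    (h : Tendsto (fun s => (g s - g 0) / s ^ 2) (𝓝[≠] 0) (𝓝 l)) :
    deriv g 0 = 0 ∧ deriv (deriv g) 0 = 2 * l := by
  have hd : ∀ᶠ s in 𝓝 (0 : ℝ), DifferentiableAt ℝ g s :=
    (hg.eventually (by simp)).mono fun s hs => hs.differentiableAt (by simp)
  have hd1 : DifferentiableAt ℝ (deriv g) 0 := by
    have h1 : ContDiffAt ℝ 1 (fderiv ℝ g) 0 := hg.fderiv_right (by norm_num)
    exact (h1.differentiableAt one_ne_zero).clm_apply (differentiableAt_const (1 : ℝ))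
  have h0 : deriv g 0 = 0 := by
    have h1 : Tendsto (fun s => (g s - g 0) / s) (𝓝[≠] 0) (𝓝 0) := by
      have h2 : Tendsto (fun s : ℝ => s) (𝓝[≠] 0) (𝓝 0) := tendsto_nhdsWithin_of_tendsto_nhds tendsto_id
      have h3 := h.mul h2
      rw [mul_zero] at h3
      refine h3.congr' ?_
      filter_upwards [self_mem_nhdsWithin] with s hs
      have : s ≠ 0 := hs
      field_simp
    have h2 := hd.self_of_nhds.hasDerivAt.tendsto_slope
    refine tendsto_nhds_unique (h2.congr' ?_) h1
    filter_upwards with s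
    simp [slope_def_field]
  refine ⟨h0, ?_⟩
  have h1 : Tendsto (fun s => deriv g s / (2 * s)) (𝓝[≠] 0) (𝓝 (deriv (deriv g) 0 / 2)) := by
    have h2 := hd1.hasDerivAt.tendsto_slope.div_const 2
    refine h2.congr' ?_
    filter_upwards with s
    simp [slope_def_field, h0]
    ring
  have h2 : Tendsto (fun s => (g s - g 0) / s ^ 2) (𝓝[≠] 0) (𝓝 (deriv (deriv g) 0 / 2)) := by
    refine HasDerivAt.lhopital_zero_nhdsNE (f := fun s => g s - g 0) (g := fun s => s ^ 2)
      (f' := deriv g) (g' := fun s => 2 * s) (a := 0) ?_ ?_ ?_ ?_ ?_ h1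
    · exact eventually_nhdsWithin_of_eventually_nhds (hd.mono fun s hs => hs.hasDerivAt.sub_const _)
    · exact Eventually.of_forall fun s => by simpa using hasDerivAt_pow 2 s
    · filter_upwards [self_mem_nhdsWithin] with s hs using mul_ne_zero two_ne_zero hs
    · have h3 : ContinuousAt (fun s => g s - g 0) 0 := by
        exact hg.continuousAt.sub continuousAt_const
      simpa [ContinuousAt] using h3.tendsto.mono_left nhdsWithin_le_nhds
    · have h3 : ContinuousAt (fun s : ℝ => s ^ 2) 0 := by fun_prop
      simpa [ContinuousAt] using h3.tendsto.mono_left nhdsWithin_le_nhds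
  have := tendsto_nhds_unique h h2
  linarith

/-! ### The angle parametrization of an oscillation -/

/-- A smooth function of `y`, equal to `y` for `y ≥ y₀` and bounded below by `y₀ / 2`. Composing
with it makes quotients and square roots smooth on the whole parameter space, without changing
them where the argument is at least `y₀`. -/
noncomputable def clip (y₀ y : ℝ) : ℝ :=
  y₀ * (1 / 2 + smoothTransition (2 * (y / y₀) - 1) * (y / y₀ - 1 / 2))

theorem contDiff_clip (y₀ : ℝ) : ContDiff ℝ ∞ (clip y₀) := by
  unfold clip
  have h : ContDiff ℝ ∞ fun y : ℝ => smoothTransition (2 * (y / y₀) - 1) :=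
    smoothTransition.contDiff.comp (by fun_prop)
  fun_prop

theorem clip_pos {y₀ : ℝ} (hy : 0 < y₀) (y : ℝ) : 0 < clip y₀ y := by
  unfold clip
  refine mul_pos hy ?_
  rcases le_total (y / y₀) (1 / 2) with h | h
  · rw [smoothTransition.zero_of_nonpos (by linarith)]
    norm_num
  · have := mul_nonneg (smoothTransition.nonneg (2 * (y / y₀) - 1)) (sub_nonneg.2 h)
    linarith

theorem clip_of_le {y₀ y : ℝ} (hy : 0 < y₀) (h : y₀ ≤ y) : clip y₀ y = y := by
  have h1 : 1 ≤ y / y₀ := (one_le_div hy).2 h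
  unfold clip
  rw [smoothTransition.one_of_one_le (by linarith)]
  field_simp
  ring

/-- The parameters `(λ, m, ρ)` of an oscillation of `u` between `m - ρ` and `m + ρ`. The sign of
`ρ` records whether `u` starts at its maximum or at its minimum. -/
abbrev Param : Type := ℝ × ℝ × ℝ

/-- Twice the second divided difference of `F(u) = u²/2 - u⁴/4` at `m - ρ`, `m + ρ` and
`m + ρ c`. -/
noncomputable def secondDifference (p : Param) (c : ℝ) : ℝ :=
  1 - 3 * p.2.1 ^ 2 - 2 * p.2.1 * p.2.2 * c - p.2.2 ^ 2 * (1 + c ^ 2) / 2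

/-- The value `1 - 1 / √(1 + u_x²)` at the point where `u = m + ρ c`. -/
noncomputable def defect (p : Param) (c : ℝ) : ℝ :=
  p.1 * p.2.2 ^ 2 * (1 - c ^ 2) * secondDifference p c / 2

/-- The quantity `D` for which the flux `ψ(u_x)` equals `-ρ sin θ √D` where `c = cos θ`. -/
noncomputable def radicand (p : Param) (c : ℝ) : ℝ :=
  p.1 * secondDifference p c * (1 - defect p c / 2)

/-- The derivative `dx/dθ` of the position with respect to the angle `θ` in `u = m + ρ cos θ`,
as a function of `c = cos θ`. It is clipped to be smooth and positive for all parameters. -/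
noncomputable def slowness (y₀ : ℝ) (p : Param) (c : ℝ) : ℝ :=
  clip (1 / 2) (1 - defect p c) / √(clip y₀ (radicand p c))

/-- The position `x` at which the angle equals `θ`. -/
noncomputable def position (y₀ : ℝ) (p : Param) (θ : ℝ) : ℝ :=
  ∫ t in (0 : ℝ)..θ, slowness y₀ p (cos t)

theorem contDiff_defect : ContDiff ℝ ∞ fun z : Param × ℝ => defect z.1 z.2 := by
  unfold defect secondDifference; fun_prop

theorem contDiff_radicand : ContDiff ℝ ∞ fun z : Param × ℝ => radicand z.1 z.2 := by
  unfold radicand defect secondDifference; fun_prop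

theorem slowness_pos {y₀ : ℝ} (hy : 0 < y₀) (p : Param) (c : ℝ) : 0 < slowness y₀ p c :=
  div_pos (clip_pos (by norm_num) _) (sqrt_pos.2 (clip_pos hy _))

theorem contDiff_slowness {y₀ : ℝ} (hy : 0 < y₀) :
    ContDiff ℝ ∞ fun z : Param × ℝ => slowness y₀ z.1 z.2 := by
  unfold slowness
  refine ContDiff.div ?_ (ContDiff.sqrt ?_ fun z => (clip_pos hy _).ne')
    fun z => (sqrt_pos.2 (clip_pos hy _)).ne'
  · exact (contDiff_clip _).comp (contDiff_const.sub contDiff_defect)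
  · exact (contDiff_clip _).comp contDiff_radicand

theorem contDiff_slowness_cos {y₀ : ℝ} (hy : 0 < y₀) :
    ContDiff ℝ ∞ fun z : Param × ℝ => slowness y₀ z.1 (cos z.2) := by
  have h := (contDiff_slowness hy).comp
    (f := fun z : Param × ℝ => (z.1, cos z.2)) (by fun_prop)
  exact h

theorem continuous_slowness_cos {y₀ : ℝ} (hy : 0 < y₀) (p : Param) :
    Continuous fun t => slowness y₀ p (cos t) := by
  have h := (contDiff_slowness_cos hy).continuous.comp (Continuous.prodMk_right p)
  exact h

theorem hasDerivAt_position {y₀ : ℝ} (hy : 0 < y₀) (p : Param) (θ : ℝ) :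
    HasDerivAt (position y₀ p) (slowness y₀ p (cos θ)) θ :=
  intervalIntegral.integral_hasDerivAt_right
    ((continuous_slowness_cos hy p).intervalIntegrable _ _)
    ((continuous_slowness_cos hy p).stronglyMeasurableAtFilter _ _)
    (continuous_slowness_cos hy p).continuousAt

/-- Scaling the integration variable turns the variable endpoint into a parameter, so that smooth
dependence of integrals on parameters applies. -/
theorem contDiff_position {y₀ : ℝ} (hy : 0 < y₀) :
    ContDiff ℝ ∞ fun z : Param × ℝ => position y₀ z.1 z.2 := by
  have h1 : ∀ z : Param × ℝ, position y₀ z.1 z.2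
      = z.2 * ∫ t in (0 : ℝ)..1, slowness y₀ z.1 (cos (z.2 * t)) := by
    intro z
    have := intervalIntegral.mul_integral_comp_mul_left
      (f := fun t => slowness y₀ z.1 (cos t)) (a := 0) (b := 1) z.2
    rw [this]
    simp [position]
  simp_rw [h1]
  refine contDiff_snd.mul (contDiff_parametric_integral
    (F := fun w : (Param × ℝ) × ℝ => slowness y₀ w.1.1 (cos (w.1.2 * w.2))) ?_ 0 1)
  have h := (contDiff_slowness_cos hy).comp
    (f := fun w : (Param × ℝ) × ℝ => (w.1.1, w.1.2 * w.2)) (by fun_prop)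
  exact h

theorem position_zero (y₀ : ℝ) (p : Param) : position y₀ p 0 = 0 := by
  simp [position]

theorem strictMono_position {y₀ : ℝ} (hy : 0 < y₀) (p : Param) : StrictMono (position y₀ p) :=
  strictMono_of_hasDerivAt_pos (hasDerivAt_position hy p) fun _ => slowness_pos hy p _

theorem continuous_position {y₀ : ℝ} (hy : 0 < y₀) (p : Param) : Continuous (position y₀ p) :=
  continuous_iff_continuousAt.2 fun θ => (hasDerivAt_position hy p θ).continuousAt

/-- The slowness has a positive lower bound on the compact interval `[-1, 1]`. -/
theorem position_surjective {y₀ : ℝ} (hy : 0 < y₀) (p : Param) :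
    Function.Surjective (position y₀ p) := by
  have hc := (contDiff_slowness hy).continuous.comp (Continuous.prodMk_right p)
  obtain ⟨c₀, -, hc₀⟩ := (isCompact_Icc (a := (-1 : ℝ)) (b := 1)).exists_isMinOn ⟨0, by simp⟩
    hc.continuousOn
  set κ := slowness y₀ p c₀
  simp only [Function.comp_def] at hc₀
  have hκ : 0 < κ := slowness_pos hy p c₀
  have hle : ∀ t, κ ≤ slowness y₀ p (cos t) := fun t => hc₀ ⟨neg_one_le_cos t, cos_le_one t⟩
  have hmono : Monotone fun θ => position y₀ p θ - κ * θ := by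
    refine monotone_of_hasDerivAt_nonneg (f' := fun θ => slowness y₀ p (cos θ) - κ)
      (fun θ => ?_) fun θ => sub_nonneg.2 (hle θ)
    have h := (hasDerivAt_position hy p θ).sub ((hasDerivAt_id θ).const_mul κ)
    rw [mul_one] at h
    exact h
  refine (continuous_position hy p).surjective ?_ ?_
  · refine tendsto_atTop_mono' atTop ?_ (tendsto_id.const_mul_atTop hκ)
    filter_upwards [eventually_ge_atTop 0] with θ hθ
    have := hmono hθ
    simp only [position_zero] at this
    simp only [id]
    linarith
  · refine tendsto_atBot_mono' atBot ?_ (tendsto_id.const_mul_atBot hκ)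
    filter_upwards [eventually_le_atBot 0] with θ hθ
    have := hmono hθ
    simp only [position_zero] at this
    simp only [id]
    linarith

/-- The angle at position `x`, the inverse of `position`. -/
noncomputable def angle (y₀ : ℝ) (p : Param) : ℝ → ℝ := Function.invFun (position y₀ p)

theorem position_angle {y₀ : ℝ} (hy : 0 < y₀) (p : Param) (x : ℝ) :
    position y₀ p (angle y₀ p x) = x :=
  Function.rightInverse_invFun (position_surjective hy p) x

theorem angle_position {y₀ : ℝ} (hy : 0 < y₀) (p : Param) (θ : ℝ) :
    angle y₀ p (position y₀ p θ) = θ :=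
  Function.leftInverse_invFun (strictMono_position hy p).injective θ

theorem angle_zero {y₀ : ℝ} (hy : 0 < y₀) (p : Param) : angle y₀ p 0 = 0 := by
  conv_lhs => rw [← position_zero y₀ p]
  exact angle_position hy p 0

theorem strictMono_angle {y₀ : ℝ} (hy : 0 < y₀) (p : Param) : StrictMono (angle y₀ p) := by
  intro x y hxy
  rw [← (strictMono_position hy p).lt_iff_lt, position_angle hy, position_angle hy]
  exact hxy

/-- Joint continuity of the inverse, from monotonicity in the angle. -/
theorem continuous_angle {y₀ : ℝ} (hy : 0 < y₀) :
    Continuous fun z : Param × ℝ => angle y₀ z.1 z.2 := by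
  refine continuous_iff_continuousAt.2 fun z => Metric.continuousAt_iff'.2 fun ε hε => ?_
  have hlt := strictMono_position hy z.1
  have hc : ∀ θ, Continuous fun w : Param × ℝ => position y₀ w.1 θ := fun θ => by
    have h := (contDiff_position hy).continuous.comp
      (f := fun w : Param × ℝ => (w.1, θ)) (by fun_prop)
    exact h
  have h1 : ∀ᶠ w : Param × ℝ in 𝓝 z, position y₀ w.1 (angle y₀ z.1 z.2 - ε) < w.2 := by
    refine (hc _).continuousAt.eventually_lt continuous_snd.continuousAt ?_
    conv_rhs => rw [← position_angle hy z.1 z.2]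
    exact hlt (by linarith)
  have h2 : ∀ᶠ w : Param × ℝ in 𝓝 z, w.2 < position y₀ w.1 (angle y₀ z.1 z.2 + ε) := by
    refine continuous_snd.continuousAt.eventually_lt (hc _).continuousAt ?_
    conv_lhs => rw [← position_angle hy z.1 z.2]
    exact hlt (by linarith)
  filter_upwards [h1, h2] with w hw1 hw2
  rw [← position_angle hy w.1 w.2, (strictMono_position hy w.1).lt_iff_lt] at hw1
  have hw2' : position y₀ w.1 (angle y₀ w.1 w.2) < position y₀ w.1 (angle y₀ z.1 z.2 + ε) := by
    rwa [position_angle hy]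
  rw [(strictMono_position hy w.1).lt_iff_lt] at hw2'
  rw [Real.dist_eq, abs_lt]
  constructor <;> linarith

theorem hasDerivAt_angle {y₀ : ℝ} (hy : 0 < y₀) (p : Param) (x : ℝ) :
    HasDerivAt (angle y₀ p) (slowness y₀ p (cos (angle y₀ p x)))⁻¹ x :=
  (hasDerivAt_position hy p (angle y₀ p x)).of_local_left_inverse
    ((continuous_angle hy).comp (Continuous.prodMk_right p)).continuousAt
    (slowness_pos hy p _).ne' (Eventually.of_forall (position_angle hy p))

/-- The derivative with respect to the angle of the angular speed `dθ/dx`. -/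
noncomputable def angularSpeedDeriv (y₀ : ℝ) (p : Param) (θ : ℝ) : ℝ :=
  deriv (fun t => (slowness y₀ p (cos t))⁻¹) θ

theorem contDiff_angularSpeed {y₀ : ℝ} (hy : 0 < y₀) :
    ContDiff ℝ ∞ fun z : Param × ℝ => (slowness y₀ z.1 (cos z.2))⁻¹ :=
  (contDiff_slowness_cos hy).inv fun _ => (slowness_pos hy _ _).ne'

theorem hasDerivAt_angularSpeed {y₀ : ℝ} (hy : 0 < y₀) (p : Param) (θ : ℝ) :
    HasDerivAt (fun t => (slowness y₀ p (cos t))⁻¹) (angularSpeedDeriv y₀ p θ) θ := by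
  have h := (contDiff_angularSpeed hy).comp (contDiff_prodMk_right p)
  exact (h.differentiable (by simp) θ).hasDerivAt

theorem continuous_angularSpeedDeriv {y₀ : ℝ} (hy : 0 < y₀) :
    Continuous fun z : Param × ℝ => angularSpeedDeriv y₀ z.1 z.2 := by
  have h := contDiff_angularSpeed hy
  have h1 : ∀ z : Param × ℝ, angularSpeedDeriv y₀ z.1 z.2
      = fderiv ℝ (fun z : Param × ℝ => (slowness y₀ z.1 (cos z.2))⁻¹) z (0, 1) := by
    intro z
    have h2 := (h.differentiable (by simp) z).hasFDerivAt.comp_hasDerivAt z.2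
      (f := fun t => (z.1, t)) ((hasDerivAt_const z.2 z.1).prodMk (hasDerivAt_id z.2))
    exact h2.deriv
  simp_rw [h1]
  exact (h.continuous_fderiv (by simp)).clm_apply continuous_const

theorem hasDerivAt_cos_angle {y₀ : ℝ} (hy : 0 < y₀) (p : Param) (x : ℝ) :
    HasDerivAt (fun x => cos (angle y₀ p x))
      (-sin (angle y₀ p x) * (slowness y₀ p (cos (angle y₀ p x)))⁻¹) x :=
  (hasDerivAt_cos _).comp x (hasDerivAt_angle hy p x)

theorem hasDerivAt_deriv_cos_angle {y₀ : ℝ} (hy : 0 < y₀) (p : Param) (x : ℝ) :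
    HasDerivAt (fun x => -sin (angle y₀ p x) * (slowness y₀ p (cos (angle y₀ p x)))⁻¹)
      (-(cos (angle y₀ p x) * (slowness y₀ p (cos (angle y₀ p x)))⁻¹)
          * (slowness y₀ p (cos (angle y₀ p x)))⁻¹
        + -sin (angle y₀ p x) * (angularSpeedDeriv y₀ p (angle y₀ p x)
          * (slowness y₀ p (cos (angle y₀ p x)))⁻¹)) x :=
  ((hasDerivAt_sin _).comp x (hasDerivAt_angle hy p x)).neg.mul
    ((hasDerivAt_angularSpeed hy p _).comp x (hasDerivAt_angle hy p x))

theorem contDiff_cos_angle {y₀ : ℝ} (hy : 0 < y₀) (p : Param) :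
    ContDiff ℝ 2 fun x => cos (angle y₀ p x) := by
  have hang := (continuous_angle hy).comp (Continuous.prodMk_right p)
  have hs := (contDiff_angularSpeed hy).continuous.comp (Continuous.prodMk_right p)
  have hd := (continuous_angularSpeedDeriv hy).comp (Continuous.prodMk_right p)
  rw [show (2 : WithTop ℕ∞) = 1 + 1 by norm_num, contDiff_succ_iff_deriv]
  refine ⟨fun x => (hasDerivAt_cos_angle hy p x).differentiableAt, by simp, ?_⟩
  rw [show deriv (fun x => cos (angle y₀ p x)) = _ from
    funext fun x => (hasDerivAt_cos_angle hy p x).deriv, contDiff_one_iff_deriv]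
  refine ⟨fun x => (hasDerivAt_deriv_cos_angle hy p x).differentiableAt, ?_⟩
  rw [show deriv (fun x => -sin (angle y₀ p x) * (slowness y₀ p (cos (angle y₀ p x)))⁻¹) = _ from
    funext fun x => (hasDerivAt_deriv_cos_angle hy p x).deriv]
  have := hs.comp hang
  have := hd.comp hang
  simp only [Function.comp_def] at *
  fun_prop

/-! ### The phase plane and the profiles that solve the equation -/

theorem continuous_psi : Continuous psi := by
  unfold psi
  exact continuous_id.div (by fun_prop) fun s => (sqrt_pos.2 (by positivity)).ne'

theorem hasDerivAt_psi (s : ℝ) : HasDerivAt psi ((1 + s ^ 2) * √(1 + s ^ 2))⁻¹ s := by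
  have hpos : 0 < 1 + s ^ 2 := by positivity
  have hs := sqrt_pos.2 hpos
  have h1 : HasDerivAt (fun s : ℝ => 1 + s ^ 2) (2 * s) s := by
    simpa using (hasDerivAt_pow 2 s).const_add 1
  refine ((hasDerivAt_id s).div (h1.sqrt hpos.ne') hs.ne').congr_deriv ?_
  have h2 := sq_sqrt hpos.le
  simp only [id]
  field_simp
  rw [h2]
  ring

theorem hasDerivAt_of_hasDerivAt_psi_comp {g : ℝ → ℝ} {x w : ℝ} (hg : DifferentiableAt ℝ g x)
    (h : HasDerivAt (fun y => psi (g y)) w x) :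
    HasDerivAt g ((1 + g x ^ 2) * √(1 + g x ^ 2) * w) x := by
  have h1 := (hasDerivAt_psi (g x)).comp x hg.hasDerivAt
  have h2 := h1.unique h
  have hpos : 0 < 1 + g x ^ 2 := by positivity
  have hs := sqrt_pos.2 hpos
  refine hg.hasDerivAt.congr_deriv ?_
  rw [← h2]
  field_simp

/-- The vector field of the equation for `(u, u_x)`, with the nonlocal term replaced by a
constant `c`. -/
noncomputable def phaseField (lam c : ℝ) (z : ℝ × ℝ) : ℝ × ℝ :=
  (z.2, (1 + z.2 ^ 2) * √(1 + z.2 ^ 2) * (c - lam * f z.1))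

theorem contDiff_phaseField (lam c : ℝ) : ContDiff ℝ 1 (phaseField lam c) := by
  unfold phaseField f
  have : ContDiff ℝ 1 fun z : ℝ × ℝ => √(1 + z.2 ^ 2) :=
    ContDiff.sqrt (by fun_prop) fun z => by positivity
  fun_prop

theorem derivWithin_Icc_eq_deriv {u : ℝ → ℝ} {L x : ℝ} (hx : x ∈ Ioo 0 L) :
    derivWithin u (Icc 0 L) x = deriv u x :=
  derivWithin_of_mem_nhds (Icc_mem_nhds hx.1 hx.2)

/-- The pair `(u, u_x)` of a function of class `C²((0,L)) ∩ C¹([0,L])` solving the equation is a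
trajectory of `phaseField` up to the left endpoint, where the second derivative exists as the
limit of its values inside. -/
theorem phase_trajectory {u : ℝ → ℝ} {L lam c : ℝ} (hL : 0 < L)
    (h2 : ContDiffOn ℝ 2 u (Ioo 0 L)) (h1 : ContDiffOn ℝ 1 u (Icc 0 L))
    (heq : ∀ x ∈ Ioo 0 L, deriv (fun y => psi (deriv u y)) x + lam * f (u x) - c = 0) :
    ContinuousOn (fun x => (u x, derivWithin u (Icc 0 L) x)) (Icc 0 L) ∧
    (∀ x ∈ Ioo 0 L, HasDerivAt (fun y => psi (derivWithin u (Icc 0 L) y)) (c - lam * f (u x)) x) ∧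
    ∀ t ∈ Ico 0 L, HasDerivWithinAt (fun x => (u x, derivWithin u (Icc 0 L) x))
      (phaseField lam c (u t, derivWithin u (Icc 0 L) t)) (Ici t) t := by
  set g := derivWithin u (Icc 0 L) with hg
  have hcg : ContinuousOn g (Icc 0 L) :=
    h1.continuousOn_derivWithin (uniqueDiffOn_Icc hL) le_rfl
  have hcont : ContinuousOn (fun x => (u x, g x)) (Icc 0 L) := h1.continuousOn.prodMk hcg
  have hev : ∀ x ∈ Ioo 0 L, g =ᶠ[𝓝 x] deriv u := fun x hx => by
    filter_upwards [isOpen_Ioo.mem_nhds hx] with y hy using derivWithin_Icc_eq_deriv hy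
  have hdg : ∀ x ∈ Ioo 0 L, DifferentiableAt ℝ g x := fun x hx => by
    have h3 : ContDiffAt ℝ 1 (fderiv ℝ u) x :=
      (h2.contDiffAt (isOpen_Ioo.mem_nhds hx)).fderiv_right (by norm_num)
    have h4 : DifferentiableAt ℝ (deriv u) x :=
      (h3.differentiableAt one_ne_zero).clm_apply (differentiableAt_const (1 : ℝ))
    exact h4.congr_of_eventuallyEq (hev x hx)
  have hflux : ∀ x ∈ Ioo 0 L, HasDerivAt (fun y => psi (g y)) (c - lam * f (u x)) x := by
    intro x hx
    have h3 : DifferentiableAt ℝ (fun y => psi (g y)) x :=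
      (hasDerivAt_psi (g x)).differentiableAt.comp x (hdg x hx)
    have h4 : deriv (fun y => psi (g y)) x = deriv (fun y => psi (deriv u y)) x :=
      Filter.EventuallyEq.deriv_eq ((hev x hx).fun_comp psi)
    refine h3.hasDerivAt.congr_deriv ?_
    linarith [heq x hx]
  have hgd : ∀ x ∈ Ioo 0 L, HasDerivAt g (phaseField lam c (u x, g x)).2 x := fun x hx =>
    hasDerivAt_of_hasDerivAt_psi_comp (hdg x hx) (hflux x hx)
  refine ⟨hcont, hflux, fun t ht => ?_⟩
  have hmem : Icc 0 L ∈ 𝓝[≥] t := Icc_mem_nhdsGE_of_mem ht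
  have hu : HasDerivWithinAt u (g t) (Ici t) t :=
    ((h1.differentiableOn one_ne_zero) t ⟨ht.1, ht.2.le⟩).hasDerivWithinAt.mono_of_mem_nhdsWithin
      hmem
  refine hu.prodMk ?_
  rcases eq_or_lt_of_le ht.1 with h0 | h0
  · subst h0
    refine hasDerivWithinAt_Ici_of_tendsto_deriv (s := Ioo 0 L)
      (fun x hx => (hdg x hx).differentiableWithinAt)
      ((hcg 0 ⟨le_rfl, hL.le⟩).mono Ioo_subset_Icc_self) (Ioo_mem_nhdsGT hL) ?_
    have h5 : ContinuousOn (fun x => (phaseField lam c (u x, g x)).2) (Icc 0 L) :=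
      (continuous_snd.comp (contDiff_phaseField lam c).continuous).comp_continuousOn hcont
    have h6 := ((h5 0 ⟨le_rfl, hL.le⟩).mono Ioo_subset_Icc_self).tendsto
    rw [nhdsWithin_Ioo_eq_nhdsGT hL] at h6
    refine h6.congr' ?_
    filter_upwards [Ioo_mem_nhdsGT hL] with x hx using (hgd x hx).deriv.symm
  · exact (hgd t ⟨h0, ht.2⟩).hasDerivWithinAt

theorem eqOn_of_initial_value {u w : ℝ → ℝ} {L lam c : ℝ} (hL : 0 < L)
    (hu2 : ContDiffOn ℝ 2 u (Ioo 0 L)) (hu1 : ContDiffOn ℝ 1 u (Icc 0 L))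
    (hu : ∀ x ∈ Ioo 0 L, deriv (fun y => psi (deriv u y)) x + lam * f (u x) - c = 0)
    (hw2 : ContDiffOn ℝ 2 w (Ioo 0 L)) (hw1 : ContDiffOn ℝ 1 w (Icc 0 L))
    (hw : ∀ x ∈ Ioo 0 L, deriv (fun y => psi (deriv w y)) x + lam * f (w x) - c = 0)
    (h0 : u 0 = w 0) (h0' : derivWithin u (Icc 0 L) 0 = derivWithin w (Icc 0 L) 0) :
    EqOn u w (Icc 0 L) := by
  obtain ⟨hcu, -, hdu⟩ := phase_trajectory hL hu2 hu1 hu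
  obtain ⟨hcw, -, hdw⟩ := phase_trajectory hL hw2 hw1 hw
  set U := fun x => (u x, derivWithin u (Icc 0 L) x)
  set W := fun x => (w x, derivWithin w (Icc 0 L) x)
  obtain ⟨K, hK⟩ := (contDiff_phaseField lam c).locallyLipschitz.locallyLipschitzOn
    |>.exists_lipschitzOnWith_of_compact
    ((isCompact_Icc.image_of_continuousOn hcu).union (isCompact_Icc.image_of_continuousOn hcw))
  have h := ODE_solution_unique_of_mem_Icc_right (v := fun _ => phaseField lam c)
    (s := fun _ => U '' Icc 0 L ∪ W '' Icc 0 L) (fun _ _ => hK) hcu hdu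
    (fun t ht => Or.inl ⟨t, Ico_subset_Icc_self ht, rfl⟩) hcw hdw
    (fun t ht => Or.inr ⟨t, Ico_subset_Icc_self ht, rfl⟩) (Prod.ext h0 h0')
  exact fun x hx => congrArg Prod.fst (h hx)

/-- The oscillation `u = m + ρ cos θ` as a function of the position. -/
noncomputable def profile (y₀ : ℝ) (p : Param) (x : ℝ) : ℝ :=
  p.2.1 + p.2.2 * cos (angle y₀ p x)

/-- The clipping in `slowness` is inactive for the parameters `p`. -/
def Regular (y₀ : ℝ) (p : Param) : Prop :=
  ∀ c ∈ Icc (-1 : ℝ) 1, 1 / 2 ≤ 1 - defect p c ∧ y₀ ≤ radicand p c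

/-- The slope of the chord of `F(u) = u²/2 - u⁴/4` between `m - ρ` and `m + ρ`. The constant `c` of
the equation solved by the profile is `λ` times this slope. -/
def chordSlope (p : Param) : ℝ := p.2.1 - p.2.1 ^ 3 - p.2.1 * p.2.2 ^ 2

theorem Regular.slowness_eq {y₀ : ℝ} (hy : 0 < y₀) {p : Param} (hp : Regular y₀ p) {c : ℝ}
    (hc : c ∈ Icc (-1 : ℝ) 1) : slowness y₀ p c = (1 - defect p c) / √(radicand p c) := by
  unfold slowness
  rw [clip_of_le (by norm_num) (hp c hc).1, clip_of_le hy (hp c hc).2]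

theorem hasDerivAt_profile {y₀ : ℝ} (hy : 0 < y₀) (p : Param) (x : ℝ) :
    HasDerivAt (profile y₀ p)
      (p.2.2 * (-sin (angle y₀ p x) * (slowness y₀ p (cos (angle y₀ p x)))⁻¹)) x :=
  ((hasDerivAt_cos_angle hy p x).const_mul _).const_add _

theorem contDiff_profile {y₀ : ℝ} (hy : 0 < y₀) (p : Param) : ContDiff ℝ 2 (profile y₀ p) :=
  contDiff_const.add (contDiff_const.mul (contDiff_cos_angle hy p))

theorem Regular.psi_deriv_profile {y₀ : ℝ} (hy : 0 < y₀) {p : Param} (hp : Regular y₀ p) (x : ℝ) :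
    psi (deriv (profile y₀ p) x)
      = -(p.2.2 * sin (angle y₀ p x) * √(radicand p (cos (angle y₀ p x)))) := by
  set θ := angle y₀ p x with hθ
  have hc : cos θ ∈ Icc (-1 : ℝ) 1 := ⟨neg_one_le_cos θ, cos_le_one θ⟩
  obtain ⟨h1, h2⟩ := hp _ hc
  have hD : 0 < radicand p (cos θ) := hy.trans_le h2
  have hq : 0 < 1 - defect p (cos θ) := by linarith
  rw [(hasDerivAt_profile hy p x).deriv, ← hθ, hp.slowness_eq hy hc]
  have hid : 1 + (p.2.2 * (-sin θ * ((1 - defect p (cos θ)) / √(radicand p (cos θ)))⁻¹)) ^ 2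
      = ((1 - defect p (cos θ))⁻¹) ^ 2 := by
    have h3 := sq_sqrt hD.le
    have h4 : p.2.2 ^ 2 * sin θ ^ 2 * radicand p (cos θ) = 1 - (1 - defect p (cos θ)) ^ 2 := by
      rw [sin_sq]
      unfold radicand defect
      ring
    rw [inv_div, mul_pow, mul_pow, div_pow, h3]
    field_simp
    linarith
  unfold psi
  rw [hid, sqrt_sq (inv_pos.2 hq).le]
  field_simp

/-- The identity for the derivative of `radicand` is the equation `ψ(u_x)_x = c - λ f(u)` written
in the variable `cos θ`. -/
theorem hasDerivAt_radicand (p : Param) (c : ℝ) :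
    ∃ D' : ℝ, HasDerivAt (radicand p) D' c ∧
      p.2.2 * (c * radicand p c - (1 - c ^ 2) * D' / 2)
        = (1 - defect p c) * (p.1 * f (p.2.1 + p.2.2 * c) - p.1 * chordSlope p) := by
  have hsq : HasDerivAt (fun c : ℝ => c ^ 2) (2 * c) c := by simpa using hasDerivAt_pow 2 c
  have hR := (((hasDerivAt_id c).const_mul (2 * p.2.1 * p.2.2)).const_sub
    (1 - 3 * p.2.1 ^ 2)).sub (((hsq.const_add 1).const_mul (p.2.2 ^ 2)).div_const 2)
  have hq := (((hsq.const_sub 1).const_mul (p.1 * p.2.2 ^ 2)).mul hR).div_const 2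
  refine ⟨_, (hR.const_mul p.1).mul ((hq.div_const 2).const_sub 1), ?_⟩
  simp only [radicand, defect, secondDifference, chordSlope, f, id, Pi.sub_apply]
  ring

theorem Regular.hasDerivAt_psi_deriv_profile {y₀ : ℝ} (hy : 0 < y₀) {p : Param}
    (hp : Regular y₀ p) (x : ℝ) :
    HasDerivAt (fun x => psi (deriv (profile y₀ p) x))
      (p.1 * chordSlope p - p.1 * f (profile y₀ p x)) x := by
  simp_rw [hp.psi_deriv_profile hy]
  have hc : cos (angle y₀ p x) ∈ Icc (-1 : ℝ) 1 := ⟨neg_one_le_cos _, cos_le_one _⟩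
  have hD : 0 < radicand p (cos (angle y₀ p x)) := hy.trans_le (hp _ hc).2
  have hq : 0 < 1 - defect p (cos (angle y₀ p x)) := by linarith [(hp _ hc).1]
  have h1 := ((hasDerivAt_sin _).comp x (hasDerivAt_angle hy p x)).const_mul p.2.2
  obtain ⟨D', hD', hk⟩ := hasDerivAt_radicand p (cos (angle y₀ p x))
  have h2 := (hD'.comp x (h := fun x => cos (angle y₀ p x))
    (hasDerivAt_cos_angle hy p x)).sqrt hD.ne'
  refine (h1.mul h2).neg.congr_deriv ?_
  simp only [Function.comp_def]
  rw [hp.slowness_eq hy hc]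
  unfold profile
  set θ := angle y₀ p x
  have h3 := sq_sqrt hD.le
  have h4 := sin_sq θ
  set S := √(radicand p (cos θ))
  have hS : 0 < S := sqrt_pos.2 hD
  rw [inv_div]
  rw [← h3, ← h4] at hk
  field_simp
  linear_combination (-2) * hk

/-! ### Profiles and classical solutions -/

theorem integral_comp_angle {y₀ : ℝ} (hy : 0 < y₀) (p : Param) {G : ℝ → ℝ → ℝ}
    (hG : Continuous fun z : ℝ × ℝ => G z.1 z.2) (θ : ℝ) :
    ∫ x in (0 : ℝ)..position y₀ p θ, G (angle y₀ p x) x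
      = ∫ t in (0 : ℝ)..θ, G t (position y₀ p t) * slowness y₀ p (cos t) := by
  have hang := (continuous_angle hy).comp (Continuous.prodMk_right p)
  have hcont : Continuous fun x => G (angle y₀ p x) x :=
    hG.comp (hang.prodMk continuous_id)
  have h := intervalIntegral.integral_comp_mul_deriv (a := 0) (b := θ)
    (fun t _ => hasDerivAt_position hy p t) (continuous_slowness_cos hy p).continuousOn hcont
  rw [position_zero] at h
  rw [← h]
  simp only [Function.comp_def, angle_position hy]

/-- The integral of `u - M` over the part of the profile swept while the angle runs from `0` to
`kπ`. -/
noncomputable def massDefect (y₀ M : ℝ) (k : ℕ) (p : Param) : ℝ :=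
  ∫ t in (0 : ℝ)..k * π, (p.2.1 - M + p.2.2 * cos t) * slowness y₀ p (cos t)

theorem integral_profile {y₀ : ℝ} (hy : 0 < y₀) (p : Param) (M : ℝ) (k : ℕ) :
    ∫ x in (0 : ℝ)..position y₀ p (k * π), (profile y₀ p x - M) = massDefect y₀ M k p := by
  have h := integral_comp_angle hy p (G := fun t _ => p.2.1 - M + p.2.2 * cos t) (by fun_prop)
    (k * π)
  unfold massDefect
  rw [← h]
  refine intervalIntegral.integral_congr fun x _ => ?_
  simp only [profile]
  ring

theorem mass_eq_iff {L M : ℝ} (hL : 0 < L) {u : ℝ → ℝ}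
    (hu : IntervalIntegrable u MeasureTheory.volume 0 L) :
    1 / L * ∫ x in (0 : ℝ)..L, u x = M ↔ ∫ x in (0 : ℝ)..L, (u x - M) = 0 := by
  rw [intervalIntegral.integral_sub hu intervalIntegrable_const, intervalIntegral.integral_const]
  field_simp
  simp [sub_eq_zero]

theorem deriv_profile_of_sin_eq_zero {y₀ : ℝ} (hy : 0 < y₀) (p : Param) {x : ℝ}
    (h : sin (angle y₀ p x) = 0) : deriv (profile y₀ p) x = 0 := by
  rw [(hasDerivAt_profile hy p x).deriv, h]
  simp

theorem derivWithin_profile {y₀ L : ℝ} (hy : 0 < y₀) (hL : 0 < L) (p : Param) {x : ℝ}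
    (hx : x ∈ Icc 0 L) : derivWithin (profile y₀ p) (Icc 0 L) x = deriv (profile y₀ p) x :=
  (hasDerivAt_profile hy p x).differentiableAt.derivWithin (uniqueDiffOn_Icc hL x hx)

theorem isClassicalSolution_profile {y₀ L M : ℝ} (hy : 0 < y₀) (hL : 0 < L) {p : Param}
    (hp : Regular y₀ p) {k : ℕ} (hlen : position y₀ p (k * π) = L)
    (hmass : massDefect y₀ M k p = 0) : IsClassicalSolution L M p.1 (profile y₀ p) := by
  have hC := contDiff_profile hy p
  have hf : Continuous fun x => f (profile y₀ p x) := by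
    have := hC.continuous
    unfold f
    fun_prop
  have hang : angle y₀ p L = k * π := by rw [← hlen, angle_position hy]
  have h0 : deriv (profile y₀ p) 0 = 0 :=
    deriv_profile_of_sin_eq_zero hy p (by rw [angle_zero hy, sin_zero])
  have h1 : deriv (profile y₀ p) L = 0 :=
    deriv_profile_of_sin_eq_zero hy p (by rw [hang, sin_nat_mul_pi])
  have hint : p.1 / L * ∫ y in (0 : ℝ)..L, f (profile y₀ p y) = p.1 * chordSlope p := by
    have h2 := intervalIntegral.integral_eq_sub_of_hasDerivAt (a := 0) (b := L)
      (fun x _ => hp.hasDerivAt_psi_deriv_profile hy x)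
      ((continuous_const.sub (continuous_const.mul hf)).intervalIntegrable _ _)
    have h3 : Continuous fun x => p.1 * f (profile y₀ p x) := continuous_const.mul hf
    rw [h0, h1, sub_self, intervalIntegral.integral_sub intervalIntegrable_const
      (h3.intervalIntegrable _ _), intervalIntegral.integral_const,
      intervalIntegral.integral_const_mul, smul_eq_mul] at h2
    field_simp
    linarith
  refine ⟨hC.contDiffOn, (hC.of_le (by norm_num)).contDiffOn, fun x _ => ?_, ?_, ?_, ?_⟩
  · rw [hint, (hp.hasDerivAt_psi_deriv_profile hy x).deriv]
    ring
  · rw [derivWithin_profile hy hL p ⟨le_rfl, hL.le⟩, h0]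
  · rw [derivWithin_profile hy hL p ⟨hL.le, le_rfl⟩, h1]
  · rw [mass_eq_iff hL (hC.continuous.intervalIntegrable _ _)]
    conv_lhs => rw [← hlen]
    rw [integral_profile hy, hmass]

theorem IsClassicalSolution.eqOn_profile {y₀ L M lam : ℝ} (hy : 0 < y₀) (hL : 0 < L) {u : ℝ → ℝ}
    (hu : IsClassicalSolution L M lam u) {p : Param} (hp : Regular y₀ p) (hlam : p.1 = lam)
    (hu0 : u 0 = p.2.1 + p.2.2)
    (hc : lam / L * ∫ y in (0 : ℝ)..L, f (u y) = lam * chordSlope p) :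
    EqOn u (profile y₀ p) (Icc 0 L) := by
  have hC := contDiff_profile hy p
  refine eqOn_of_initial_value hL hu.contDiffOn_Ioo hu.contDiffOn_Icc
    (c := lam * chordSlope p) (lam := lam) ?_ hC.contDiffOn
    (hC.of_le (by norm_num)).contDiffOn ?_ ?_ ?_
  · intro x hx
    rw [← hc]
    exact hu.equation x hx
  · intro x _
    rw [(hp.hasDerivAt_psi_deriv_profile hy x).deriv, hlam]
    ring
  · rw [hu0]
    simp [profile, angle_zero hy]
  · rw [hu.neumann_left, derivWithin_profile hy hL p ⟨le_rfl, hL.le⟩,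
      deriv_profile_of_sin_eq_zero hy p (by rw [angle_zero hy, sin_zero])]

/-- The condition `u_x(L) = 0` forces the angle at `L` to be a multiple of `π`, unless `ρ = 0` and
the solution is constant. -/
theorem IsClassicalSolution.exists_length_eq {y₀ L M lam : ℝ} (hy : 0 < y₀) (hL : 0 < L)
    {u : ℝ → ℝ} (hu : IsClassicalSolution L M lam u) {p : Param}
    (h : EqOn u (profile y₀ p) (Icc 0 L)) (hne : ∃ x ∈ Icc 0 L, u x ≠ M) :
    p.2.2 ≠ 0 ∧ ∃ k : ℕ, 1 ≤ k ∧ position y₀ p (k * π) = L ∧ massDefect y₀ M k p = 0 := by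
  have hC := contDiff_profile hy p
  have hmass : ∫ x in (0 : ℝ)..L, (profile y₀ p x - M) = 0 := by
    have h1 := (mass_eq_iff hL (hu.contDiffOn_Icc.continuousOn.intervalIntegrable_of_Icc hL.le)).1
      hu.mass
    refine Eq.trans (intervalIntegral.integral_congr fun x hx => ?_) h1
    rw [uIcc_of_le hL.le] at hx
    simp only [h hx]
  have hρ : p.2.2 ≠ 0 := by
    intro hρ
    obtain ⟨x, hx, hxM⟩ := hne
    apply hxM
    have hconst : ∀ x, profile y₀ p x = p.2.1 := fun x => by simp [profile, hρ]
    simp only [hconst, intervalIntegral.integral_const, sub_zero, smul_eq_mul, mul_eq_zero,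
      hL.ne', false_or] at hmass
    rw [h hx, hconst]
    linarith
  refine ⟨hρ, ?_⟩
  have hd : deriv (profile y₀ p) L = 0 := by
    rw [← derivWithin_profile hy hL p ⟨hL.le, le_rfl⟩,
      ← derivWithin_congr h (h ⟨hL.le, le_rfl⟩), hu.neumann_right]
  have hs : sin (angle y₀ p L) = 0 := by
    rw [(hasDerivAt_profile hy p L).deriv] at hd
    have := (slowness_pos hy p (cos (angle y₀ p L))).ne'
    simpa [hρ, this] using hd
  obtain ⟨n, hn⟩ := sin_eq_zero_iff.1 hs
  have hpos : 0 < angle y₀ p L := by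
    rw [← angle_zero hy p]
    exact strictMono_angle hy p hL
  have hn0 : 0 < n := by
    rw [← hn] at hpos
    exact_mod_cast (mul_pos_iff_of_pos_right pi_pos).1 hpos
  lift n to ℕ using hn0.le
  have hlen : position y₀ p (n * π) = L := by
    rw [← position_angle hy p L, ← hn]
    simp
  exact ⟨n, by exact_mod_cast hn0, hlen, by rw [← integral_profile hy, hlen, hmass]⟩

/-! ### Solutions close to a constant are profiles -/

theorem one_sub_three_sq_pos {M : ℝ} (hM : |M| < 1 / √3) : 0 < 1 - 3 * M ^ 2 := by
  have h3 : (0 : ℝ) < √3 := sqrt_pos.2 (by norm_num)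
  have h : |M| ^ 2 < (1 / √3) ^ 2 := pow_lt_pow_left₀ hM (abs_nonneg _) two_ne_zero
  rw [sq_abs, div_pow, sq_sqrt (by norm_num)] at h
  linarith

theorem continuous_f : Continuous f := by
  unfold f; fun_prop

theorem IsClassicalSolution.abs_sub_le {L M lam ε : ℝ} (hL : 0 < L) {u : ℝ → ℝ}
    (hu : IsClassicalSolution L M lam u) (hε : C2Close L ε u fun _ => M) {x : ℝ}
    (hx : x ∈ Icc 0 L) : |u x - M| ≤ ε := by
  have hcl : closure (Ioo 0 L) = Icc 0 L := closure_Ioo hL.ne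
  refine le_on_closure (s := Ioo 0 L) (f := fun x => |u x - M|) (g := fun _ => ε)
    (fun y hy => (hε y hy).1.le) ?_ continuousOn_const (by rwa [hcl])
  rw [hcl]
  exact (hu.contDiffOn_Icc.continuousOn.sub continuousOn_const).abs

/-- Parameters are determined by `λ`, one turning value `b`, and the slope of the chord of `F`
from `b` to the other turning value: that slope is increasing in the other value near `M`,
because `f'(M) > 0`. -/
theorem exists_param_of_secant {M : ℝ} (hM : 0 < 1 - 3 * M ^ 2) (lam₀ : ℝ) {N : Set Param}
    (hN : N ∈ 𝓝 (lam₀, M, (0 : ℝ))) :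
    ∃ ε > 0, ∀ lam b y : ℝ, |lam - lam₀| < ε → |b - M| < ε → |y - f M| < ε →
      ∃ p ∈ N, p.1 = lam ∧ p.2.1 + p.2.2 = b ∧ chordSlope p = y := by
  have hcont : Continuous fun z : ℝ × ℝ × ℝ => (z.1, (z.2.1 + z.2.2) / 2, (z.2.2 - z.2.1) / 2) := by
    fun_prop
  have h1 : ∀ᶠ z : ℝ × ℝ × ℝ in 𝓝 (lam₀, M, M),
      ((z.1, (z.2.1 + z.2.2) / 2, (z.2.2 - z.2.1) / 2) : Param) ∈ N := by
    refine hcont.continuousAt.eventually_mem ?_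
    simpa using hN
  obtain ⟨r, hr, hball⟩ := Metric.eventually_nhds_iff.1 h1
  obtain ⟨h, hh, hhr⟩ : ∃ h : ℝ, 0 < h ∧ h < r ∧ h < 1 ∧ h * (2 * |M| + 1) < 1 - 3 * M ^ 2 := by
    have hev : ∀ᶠ h : ℝ in 𝓝 0, h < r ∧ h < 1 ∧ h * (2 * |M| + 1) < 1 - 3 * M ^ 2 := by
      refine (gt_mem_nhds hr).and ((gt_mem_nhds one_pos).and ?_)
      have hc : ContinuousAt (fun h : ℝ => h * (2 * |M| + 1)) 0 := by fun_prop
      exact hc.eventually_lt_const (by simpa using hM)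
    exact (((hev.filter_mono nhdsWithin_le_nhds).and
      (self_mem_nhdsWithin (s := Ioi (0 : ℝ)))).exists).imp fun h hh => ⟨hh.2, hh.1⟩
  obtain ⟨hhr, hh1, hhM⟩ := hhr
  -- `G a b` is the slope of the chord of `F` from `a` to `b`.
  set G : ℝ → ℝ → ℝ := fun a b => chordSlope (lam₀, (a + b) / 2, (b - a) / 2) with hG
  have hGc : Continuous fun z : ℝ × ℝ => G z.1 z.2 := by
    simp only [hG, chordSlope]; fun_prop
  have hMabs := abs_le.1 (le_refl |M|)
  have hup : f M < G (M + h) M := by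
    have : G (M + h) M - f M = h / 2 * ((1 - 3 * M ^ 2) - 2 * M * h - h ^ 2 / 2) := by
      simp only [hG, chordSlope, f]; ring
    have h2 : 0 < (1 - 3 * M ^ 2) - 2 * M * h - h ^ 2 / 2 := by nlinarith
    nlinarith [mul_pos (half_pos hh) h2]
  have hdown : G (M - h) M < f M := by
    have : G (M - h) M - f M = -(h / 2 * ((1 - 3 * M ^ 2) + 2 * M * h - h ^ 2 / 2)) := by
      simp only [hG, chordSlope, f]; ring
    have h2 : 0 < (1 - 3 * M ^ 2) + 2 * M * h - h ^ 2 / 2 := by nlinarith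
    nlinarith [mul_pos (half_pos hh) h2]
  have hev : ∀ᶠ z : ℝ × ℝ in 𝓝 (M, f M), G (M - h) z.1 < z.2 ∧ z.2 < G (M + h) z.1 := by
    refine ContinuousAt.eventually_lt (f := fun z : ℝ × ℝ => G (M - h) z.1) (g := fun z => z.2)
      ?_ continuousAt_snd hdown |>.and
      (ContinuousAt.eventually_lt (f := fun z : ℝ × ℝ => z.2) (g := fun z => G (M + h) z.1)
        continuousAt_snd ?_ hup)
    · exact (hGc.comp (f := fun z : ℝ × ℝ => (M - h, z.1)) (by fun_prop)).continuousAt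
    · exact (hGc.comp (f := fun z : ℝ × ℝ => (M + h, z.1)) (by fun_prop)).continuousAt
  obtain ⟨r', hr', hball'⟩ := Metric.eventually_nhds_iff.1 hev
  refine ⟨min r r', lt_min hr hr', fun lam b y hlam hb hy => ?_⟩
  have hz : dist (b, y) (M, f M) < r' := by
    rw [Prod.dist_eq, max_lt_iff]
    exact ⟨hb.trans_le (min_le_right _ _), hy.trans_le (min_le_right _ _)⟩
  obtain ⟨hl, hu⟩ := hball' hz
  have hcb : Continuous fun a => G a b :=
    hGc.comp (f := fun a : ℝ => (a, b)) (by fun_prop)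
  obtain ⟨a, ha, hay⟩ := intermediate_value_Icc (a := M - h) (b := M + h) (by linarith)
    hcb.continuousOn ⟨hl.le, hu.le⟩
  refine ⟨(lam, (a + b) / 2, (b - a) / 2), ?_, rfl, ?_, hay⟩
  · refine hball (y := (lam, a, b)) ?_
    rw [Prod.dist_eq, Prod.dist_eq, max_lt_iff, max_lt_iff]
    refine ⟨hlam.trans_le (min_le_left _ _), ?_, hb.trans_le (min_le_left _ _)⟩
    rw [Real.dist_eq, abs_lt]
    constructor <;> linarith [ha.1, ha.2]
  · simp only
    ring

theorem abs_average_sub_le {L η y : ℝ} (hL : 0 < L) {g : ℝ → ℝ} (hg : ContinuousOn g (Icc 0 L))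
    (h : ∀ x ∈ Icc 0 L, |g x - y| ≤ η) : |1 / L * (∫ x in (0 : ℝ)..L, g x) - y| ≤ η := by
  have hi := hg.intervalIntegrable_of_Icc (μ := MeasureTheory.volume) hL.le
  have h1 := intervalIntegral.norm_integral_le_of_norm_le_const (a := 0) (b := L) (C := η)
    (f := fun x => g x - y) (fun x hx => by
      rw [uIoc_of_le hL.le] at hx
      exact h x (Ioc_subset_Icc_self hx))
  rw [intervalIntegral.integral_sub hi intervalIntegrable_const, intervalIntegral.integral_const,
    sub_zero, smul_eq_mul, abs_of_pos hL, Real.norm_eq_abs] at h1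
  have h2 : 1 / L * (∫ x in (0 : ℝ)..L, g x) - y = ((∫ x in (0 : ℝ)..L, g x) - L * y) / L := by
    field_simp
  rw [h2, abs_div, abs_of_pos hL, div_le_iff₀ hL]
  exact h1

theorem eventually_forall_Icc {P : Param → ℝ → Prop} {p₀ : Param} {a b : ℝ}
    (h : ∀ c ∈ Icc a b, ∀ᶠ z : Param × ℝ in 𝓝 (p₀, c), P z.1 z.2) :
    ∀ᶠ p in 𝓝 p₀, ∀ c ∈ Icc a b, P p c :=
  isCompact_Icc.eventually_forall_of_forall_eventually (P := P) h

theorem secondDifference_of_rho_eq_zero (lam m c : ℝ) :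
    secondDifference (lam, m, 0) c = 1 - 3 * m ^ 2 := by
  simp [secondDifference]

theorem defect_of_rho_eq_zero (lam m c : ℝ) : defect (lam, m, 0) c = 0 := by
  simp [defect]

theorem radicand_of_rho_eq_zero (lam m c : ℝ) :
    radicand (lam, m, 0) c = lam * (1 - 3 * m ^ 2) := by
  simp [radicand, secondDifference_of_rho_eq_zero, defect_of_rho_eq_zero]

theorem eventually_regular {y₀ lam₀ M : ℝ} (h : y₀ < lam₀ * (1 - 3 * M ^ 2)) :
    ∀ᶠ p in 𝓝 ((lam₀, M, 0) : Param), Regular y₀ p := by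
  refine eventually_forall_Icc (P := fun p c => 1 / 2 ≤ 1 - defect p c ∧ y₀ ≤ radicand p c)
    fun c _ => ?_
  have h1 : ∀ᶠ z : Param × ℝ in 𝓝 ((lam₀, M, 0), c), defect z.1 z.2 < 1 / 2 :=
    contDiff_defect.continuous.continuousAt.eventually_lt_const
      (by simp only [defect_of_rho_eq_zero]; norm_num)
  have h2 : ∀ᶠ z : Param × ℝ in 𝓝 ((lam₀, M, 0), c), y₀ < radicand z.1 z.2 :=
    contDiff_radicand.continuous.continuousAt.eventually_const_lt
      (by simpa only [radicand_of_rho_eq_zero] using h)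
  filter_upwards [h1, h2] with z hz1 hz2 using ⟨by linarith, hz2.le⟩

/-- Every nonconstant solution close to `(λ₀, M)` is a profile with parameters close to
`(λ₀, M, 0)`. -/
theorem solution_near_constant {y₀ L M lam₀ : ℝ} (hy : 0 < y₀) (hL : 0 < L)
    (hM : 0 < 1 - 3 * M ^ 2) (hy₀ : y₀ < lam₀ * (1 - 3 * M ^ 2)) {N : Set Param}
    (hN : N ∈ 𝓝 (lam₀, M, (0 : ℝ))) :
    ∃ ε > 0, ∀ (lam : ℝ) (u : ℝ → ℝ), |lam - lam₀| < ε → IsClassicalSolution L M lam u →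
      C2Close L ε u (fun _ => M) → (∃ x ∈ Icc 0 L, u x ≠ M) →
      ∃ p ∈ N, p.1 = lam ∧ p.2.2 ≠ 0 ∧ EqOn u (profile y₀ p) (Icc 0 L) ∧
        ∃ k : ℕ, 1 ≤ k ∧ position y₀ p (k * π) = L ∧ massDefect y₀ M k p = 0 := by
  obtain ⟨ε, hε, H⟩ := exists_param_of_secant hM lam₀ (inter_mem hN (eventually_regular hy₀))
  obtain ⟨ε', hε', H'⟩ := Metric.continuousAt_iff.1 (continuous_f.continuousAt (x := M)) (ε / 2)
    (by positivity)
  refine ⟨min (ε / 2) (ε' / 2), by positivity, fun lam u hlam hu hclose hne => ?_⟩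
  have hux : ∀ x ∈ Icc 0 L, |u x - M| ≤ min (ε / 2) (ε' / 2) := fun x hx =>
    hu.abs_sub_le hL hclose hx
  have hfu : ContinuousOn (fun x => f (u x)) (Icc 0 L) :=
    continuous_f.comp_continuousOn hu.contDiffOn_Icc.continuousOn
  have havg := abs_average_sub_le (η := ε / 2) (y := f M) hL hfu fun x hx =>
    (H' (x := u x) (((hux x hx).trans (min_le_right _ _)).trans_lt (by linarith))).le
  obtain ⟨p, ⟨hpN, hpR⟩, hp1, hp2, hp3⟩ := H lam (u 0) (1 / L * ∫ x in (0 : ℝ)..L, f (u x))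
    (hlam.trans_le ((min_le_left _ _).trans (by linarith)))
    (((hux 0 ⟨le_rfl, hL.le⟩).trans (min_le_left _ _)).trans_lt (by linarith))
    (havg.trans_lt (by linarith))
  have hEq : EqOn u (profile y₀ p) (Icc 0 L) := hu.eqOn_profile hy hL hpR hp1 hp2.symm (by
    rw [hp3]; ring)
  obtain ⟨hρ, hk⟩ := hu.exists_length_eq hy hL hEq hne
  exact ⟨p, hpN, hp1, hρ, hEq, hk⟩

/-! ### Expansion of length and mass to second order in the half-amplitude -/

/-- The angular speed `dθ/dx` in the limit `ρ = 0`. -/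
noncomputable def frequency (y₀ : ℝ) (p : Param) : ℝ := √(clip y₀ (p.1 * (1 - 3 * p.2.1 ^ 2)))

/-- The clipped square root in the denominator of `slowness`. -/
noncomputable def rootRadicand (y₀ : ℝ) (p : Param) (c : ℝ) : ℝ := √(clip y₀ (radicand p c))

/-- The quotient `defect / ρ²`, as a polynomial. -/
noncomputable def defectCoeff (p : Param) (c : ℝ) : ℝ :=
  p.1 * (1 - c ^ 2) * secondDifference p c / 2

/-- The second-order term of `radicand` divided by `ρ²`, as a polynomial: `radicand` is
`λ (1 - 3m²) - 2 λ m ρ c + ρ² radicandCoeff`. -/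
noncomputable def radicandCoeff (p : Param) (c : ℝ) : ℝ :=
  -(p.1 * (1 + c ^ 2) / 2) - p.1 * secondDifference p c * defectCoeff p c / 2

/-- The remainder of second order in `ρ` of the slowness, divided by `ρ²`. It is continuous
across `ρ = 0`. -/
noncomputable def slownessCoeff (y₀ : ℝ) (p : Param) (c : ℝ) : ℝ :=
  -(radicandCoeff p c / (2 * frequency y₀ p ^ 3))
    + (-2 * p.1 * p.2.1 * c + p.2.2 * radicandCoeff p c) ^ 2
      * ((rootRadicand y₀ p c + 2 * frequency y₀ p)
        / (2 * frequency y₀ p ^ 3 * rootRadicand y₀ p c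
          * (frequency y₀ p + rootRadicand y₀ p c) ^ 2))
    - defectCoeff p c / rootRadicand y₀ p c

theorem frequency_pos {y₀ : ℝ} (hy : 0 < y₀) (p : Param) : 0 < frequency y₀ p :=
  sqrt_pos.2 (clip_pos hy _)

theorem rootRadicand_pos {y₀ : ℝ} (hy : 0 < y₀) (p : Param) (c : ℝ) : 0 < rootRadicand y₀ p c :=
  sqrt_pos.2 (clip_pos hy _)

theorem frequency_sq {y₀ : ℝ} (hy : 0 < y₀) {p : Param} (hp0 : y₀ ≤ p.1 * (1 - 3 * p.2.1 ^ 2)) :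
    frequency y₀ p ^ 2 = p.1 * (1 - 3 * p.2.1 ^ 2) := by
  unfold frequency
  rw [sq_sqrt (clip_pos hy _).le, clip_of_le hy hp0]

theorem continuous_frequency (y₀ : ℝ) : Continuous (frequency y₀) := by
  unfold frequency
  exact ((contDiff_clip y₀).continuous.comp (by fun_prop)).sqrt

theorem continuous_slownessCoeff {y₀ : ℝ} (hy : 0 < y₀) :
    Continuous fun z : Param × ℝ => slownessCoeff y₀ z.1 z.2 := by
  have ha : Continuous fun z : Param × ℝ => frequency y₀ z.1 :=
    (continuous_frequency y₀).comp continuous_fst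
  have hb : Continuous fun z : Param × ℝ => rootRadicand y₀ z.1 z.2 :=
    ((contDiff_clip y₀).continuous.comp contDiff_radicand.continuous).sqrt
  have hq : Continuous fun z : Param × ℝ => defectCoeff z.1 z.2 := by
    unfold defectCoeff secondDifference; fun_prop
  have hE : Continuous fun z : Param × ℝ => radicandCoeff z.1 z.2 := by
    unfold radicandCoeff defectCoeff secondDifference; fun_prop
  have ha0 : ∀ z : Param × ℝ, frequency y₀ z.1 ≠ 0 := fun z => (frequency_pos hy _).ne'
  have hb0 : ∀ z : Param × ℝ, rootRadicand y₀ z.1 z.2 ≠ 0 := fun z => (rootRadicand_pos hy _ _).ne'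
  have hab0 : ∀ z : Param × ℝ, frequency y₀ z.1 + rootRadicand y₀ z.1 z.2 ≠ 0 := fun z =>
    (add_pos (frequency_pos hy _) (rootRadicand_pos hy _ _)).ne'
  unfold slownessCoeff
  refine Continuous.sub (Continuous.add ?_ (Continuous.mul ?_ (Continuous.div ?_ ?_ ?_)))
    (hq.div hb hb0)
  · exact (hE.div (by fun_prop) fun z => by have := ha0 z; positivity).neg
  · fun_prop
  · fun_prop
  · fun_prop
  · intro z
    have h1 := ha0 z
    have h2 := hb0 z
    have h3 := hab0 z
    positivity

/-- An exact second-order expansion in `ρ`, with a remainder coefficient continuous at `ρ = 0`.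
It rests on the exact first-order Taylor formula for `1 / b` in terms of `b²` around `a²`. -/
theorem slowness_expansion {y₀ : ℝ} (hy : 0 < y₀) {p : Param} (hp : Regular y₀ p)
    (hp0 : y₀ ≤ p.1 * (1 - 3 * p.2.1 ^ 2)) {c : ℝ} (hc : c ∈ Icc (-1 : ℝ) 1) :
    slowness y₀ p c = (frequency y₀ p)⁻¹ + p.2.2 * (p.1 * p.2.1 / frequency y₀ p ^ 3) * c
      + p.2.2 ^ 2 * slownessCoeff y₀ p c := by
  obtain ⟨hq, hD⟩ := hp c hc
  have ha := frequency_pos hy p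
  have hb := rootRadicand_pos hy p c
  have ha2 := frequency_sq hy hp0
  have hb2 : rootRadicand y₀ p c ^ 2 = radicand p c := by
    unfold rootRadicand
    rw [sq_sqrt (clip_pos hy _).le, clip_of_le hy hD]
  have hτ : slowness y₀ p c = (1 - p.2.2 ^ 2 * defectCoeff p c) / rootRadicand y₀ p c := by
    unfold slowness rootRadicand
    rw [clip_of_le (by norm_num) hq]
    congr 1
    unfold defect defectCoeff
    ring
  have hdiff : rootRadicand y₀ p c ^ 2 - frequency y₀ p ^ 2
      = p.2.2 * (-2 * p.1 * p.2.1 * c + p.2.2 * radicandCoeff p c) := by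
    rw [hb2, ha2]
    unfold radicand defect radicandCoeff defectCoeff secondDifference
    ring
  rw [hτ]
  unfold slownessCoeff
  generalize frequency y₀ p = a at *
  generalize rootRadicand y₀ p c = b at *
  generalize defectCoeff p c = q at *
  generalize radicandCoeff p c = E at *
  have hab : (0 : ℝ) < a + b := by linarith
  have h1 : b⁻¹ = a⁻¹ - (b ^ 2 - a ^ 2) / (2 * a ^ 3)
      + (b ^ 2 - a ^ 2) ^ 2 * ((b + 2 * a) / (2 * a ^ 3 * b * (a + b) ^ 2)) := by
    field_simp
    ring
  rw [sub_div, one_div, h1, hdiff]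
  field_simp
  ring

/-- The coefficient of `ρ²` in the length of `k` half-oscillations. -/
noncomputable def lengthCoeff (y₀ : ℝ) (k : ℕ) (p : Param) : ℝ :=
  ∫ t in (0 : ℝ)..k * π, slownessCoeff y₀ p (cos t)

/-- The coefficient of `ρ²` in the mass defect, up to the contribution of `m - M`. -/
noncomputable def massCoeff (y₀ : ℝ) (k : ℕ) (p : Param) : ℝ :=
  p.1 * p.2.1 / frequency y₀ p ^ 3 * (k * π / 2)
    + p.2.2 * ∫ t in (0 : ℝ)..k * π, cos t * slownessCoeff y₀ p (cos t)

theorem continuous_slownessCoeff_cos {y₀ : ℝ} (hy : 0 < y₀) :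
    Continuous fun z : Param × ℝ => slownessCoeff y₀ z.1 (cos z.2) := by
  have h := (continuous_slownessCoeff hy).comp
    (f := fun z : Param × ℝ => (z.1, cos z.2)) (by fun_prop)
  exact h

theorem continuous_lengthCoeff {y₀ : ℝ} (hy : 0 < y₀) (k : ℕ) :
    Continuous (lengthCoeff y₀ k) :=
  intervalIntegral.continuous_parametric_intervalIntegral_of_continuous'
    (f := fun p t => slownessCoeff y₀ p (cos t)) (continuous_slownessCoeff_cos hy) _ _

theorem continuous_massCoeff {y₀ : ℝ} (hy : 0 < y₀) (k : ℕ) :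
    Continuous (massCoeff y₀ k) := by
  have h1 : Continuous fun p : Param => ∫ t in (0 : ℝ)..k * π, cos t * slownessCoeff y₀ p (cos t) :=
    intervalIntegral.continuous_parametric_intervalIntegral_of_continuous'
      (f := fun p t => cos t * slownessCoeff y₀ p (cos t))
      ((continuous_cos.comp continuous_snd).mul (continuous_slownessCoeff_cos hy)) _ _
  have h2 := continuous_frequency y₀
  unfold massCoeff
  refine ((Continuous.div (by fun_prop) (by fun_prop) fun p => ?_).mul continuous_const).add
    (by fun_prop)
  exact pow_ne_zero _ (frequency_pos hy p).ne'

theorem integral_cos_nat_mul_pi (k : ℕ) : ∫ t in (0 : ℝ)..k * π, cos t = 0 := by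
  simp [sin_nat_mul_pi]

theorem integral_cos_sq_nat_mul_pi (k : ℕ) : ∫ t in (0 : ℝ)..k * π, cos t ^ 2 = k * π / 2 := by
  simp [integral_cos_sq, sin_nat_mul_pi]

/-- The first-order term is absent because `cos` integrates to zero over `[0, kπ]`. -/
theorem length_expansion {y₀ : ℝ} (hy : 0 < y₀) {p : Param} (hp : Regular y₀ p)
    (hp0 : y₀ ≤ p.1 * (1 - 3 * p.2.1 ^ 2)) (k : ℕ) :
    position y₀ p (k * π) = k * π / frequency y₀ p + p.2.2 ^ 2 * lengthCoeff y₀ k p := by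
  have hW := (continuous_slownessCoeff_cos hy).comp (Continuous.prodMk_right p)
  simp only [Function.comp_def] at hW
  unfold position lengthCoeff
  rw [intervalIntegral.integral_congr (fun t _ =>
    slowness_expansion hy hp hp0 ⟨neg_one_le_cos t, cos_le_one t⟩),
    intervalIntegral.integral_add (Continuous.intervalIntegrable (by fun_prop) _ _)
      (Continuous.intervalIntegrable (by fun_prop) _ _),
    intervalIntegral.integral_add (Continuous.intervalIntegrable (by fun_prop) _ _)
      (Continuous.intervalIntegrable (by fun_prop) _ _),
    intervalIntegral.integral_const_mul, intervalIntegral.integral_const_mul,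
    integral_cos_nat_mul_pi, intervalIntegral.integral_const, smul_eq_mul]
  ring

theorem massDefect_eq {y₀ : ℝ} (hy : 0 < y₀) (M : ℝ) (k : ℕ) (p : Param) :
    massDefect y₀ M k p = (p.2.1 - M) * position y₀ p (k * π)
      + p.2.2 * ∫ t in (0 : ℝ)..k * π, cos t * slowness y₀ p (cos t) := by
  have hτ := continuous_slowness_cos hy p
  have h3 : ∀ t, (p.2.1 - M + p.2.2 * cos t) * slowness y₀ p (cos t)
      = (p.2.1 - M) * slowness y₀ p (cos t) + p.2.2 * (cos t * slowness y₀ p (cos t)) :=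
    fun t => by ring
  unfold massDefect position
  simp_rw [h3]
  rw [intervalIntegral.integral_add (Continuous.intervalIntegrable (by fun_prop) _ _)
        (Continuous.intervalIntegrable (by fun_prop) _ _),
      intervalIntegral.integral_const_mul, intervalIntegral.integral_const_mul]

theorem mass_expansion {y₀ : ℝ} (hy : 0 < y₀) {p : Param} (hp : Regular y₀ p)
    (hp0 : y₀ ≤ p.1 * (1 - 3 * p.2.1 ^ 2)) (M : ℝ) (k : ℕ) :
    massDefect y₀ M k p
      = (p.2.1 - M) * position y₀ p (k * π) + p.2.2 ^ 2 * massCoeff y₀ k p := by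
  have hW := (continuous_slownessCoeff_cos hy).comp (Continuous.prodMk_right p)
  simp only [Function.comp_def] at hW
  have h1 : ∫ t in (0 : ℝ)..k * π, cos t * slowness y₀ p (cos t) = p.2.2 * massCoeff y₀ k p := by
    have h2 : ∀ t, cos t * slowness y₀ p (cos t) = (frequency y₀ p)⁻¹ * cos t
        + p.2.2 * (p.1 * p.2.1 / frequency y₀ p ^ 3) * cos t ^ 2
        + p.2.2 ^ 2 * (cos t * slownessCoeff y₀ p (cos t)) := fun t => by
      rw [slowness_expansion hy hp hp0 ⟨neg_one_le_cos t, cos_le_one t⟩]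
      ring
    simp_rw [h2]
    rw [intervalIntegral.integral_add (Continuous.intervalIntegrable (by fun_prop) _ _)
        (Continuous.intervalIntegrable (by fun_prop) _ _),
      intervalIntegral.integral_add (Continuous.intervalIntegrable (by fun_prop) _ _)
        (Continuous.intervalIntegrable (by fun_prop) _ _),
      intervalIntegral.integral_const_mul, intervalIntegral.integral_const_mul,
      intervalIntegral.integral_const_mul,
      integral_cos_nat_mul_pi, integral_cos_sq_nat_mul_pi]
    unfold massCoeff
    ring
  rw [massDefect_eq hy, h1]
  ring

theorem slowness_at_constant {y₀ lam m : ℝ} (hy : 0 < y₀) (h : y₀ ≤ lam * (1 - 3 * m ^ 2))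
    (c : ℝ) : slowness y₀ (lam, m, 0) c = (√(lam * (1 - 3 * m ^ 2)))⁻¹ := by
  unfold slowness
  rw [radicand_of_rho_eq_zero, defect_of_rho_eq_zero, clip_of_le hy h,
    clip_of_le (by norm_num) (by norm_num)]
  simp

theorem lengthCoeff_at_constant {y₀ lam M : ℝ} (hy : 0 < y₀) (h : y₀ ≤ lam * (1 - 3 * M ^ 2))
    (k : ℕ) : lengthCoeff y₀ k (lam, M, 0) = k * π / √(lam * (1 - 3 * M ^ 2)) *
      (3 * lam / (8 * (lam * (1 - 3 * M ^ 2))) - 3 * (lam * (1 - 3 * M ^ 2)) / 16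
        + 3 * lam ^ 2 * M ^ 2 / (4 * (lam * (1 - 3 * M ^ 2)) ^ 2)) := by
  have hpos : 0 < lam * (1 - 3 * M ^ 2) := hy.trans_le h
  have hs : √(lam * (1 - 3 * M ^ 2)) ^ 2 = lam * (1 - 3 * M ^ 2) := sq_sqrt hpos.le
  have ha : 0 < √(lam * (1 - 3 * M ^ 2)) := sqrt_pos.2 hpos
  have hW : ∀ c, slownessCoeff y₀ (lam, M, 0) c
      = (lam / (4 * √(lam * (1 - 3 * M ^ 2)) ^ 3) - 3 * √(lam * (1 - 3 * M ^ 2)) / 8)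
        + (lam / (4 * √(lam * (1 - 3 * M ^ 2)) ^ 3) + 3 * √(lam * (1 - 3 * M ^ 2)) / 8
          + 3 * lam ^ 2 * M ^ 2 / (2 * √(lam * (1 - 3 * M ^ 2)) ^ 5)) * c ^ 2 := by
    intro c
    unfold slownessCoeff rootRadicand frequency radicandCoeff defectCoeff
    rw [radicand_of_rho_eq_zero, clip_of_le hy h, secondDifference_of_rho_eq_zero]
    simp only
    generalize √(lam * (1 - 3 * M ^ 2)) = a at *
    have hE : -(lam * (1 + c ^ 2) / 2)
        - lam * (1 - 3 * M ^ 2) * (lam * (1 - c ^ 2) * (1 - 3 * M ^ 2) / 2) / 2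
        = -(lam * (1 + c ^ 2) / 2) - a ^ 4 * (1 - c ^ 2) / 4 := by
      linear_combination (1 - c ^ 2) / 4 * (a ^ 2 + lam * (1 - 3 * M ^ 2)) * hs
    have hq : lam * (1 - c ^ 2) * (1 - 3 * M ^ 2) / 2 = a ^ 2 * (1 - c ^ 2) / 2 := by
      linear_combination -(1 - c ^ 2) / 2 * hs
    rw [hE, hq]
    field_simp
    ring
  unfold lengthCoeff
  simp_rw [hW]
  rw [intervalIntegral.integral_add (Continuous.intervalIntegrable (by fun_prop) _ _)
        (Continuous.intervalIntegrable (by fun_prop) _ _),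
      intervalIntegral.integral_const_mul, intervalIntegral.integral_const,
      integral_cos_sq_nat_mul_pi, smul_eq_mul]
  generalize √(lam * (1 - 3 * M ^ 2)) = a at *
  rw [← hs]
  field_simp
  ring

/-! ### The branch map and its derivative at the constant solution -/

/-- The inverse function theorem with an inverse that is smooth on a neighbourhood, not only at
the image point: invertibility of the derivative is an open condition. -/
theorem exists_smooth_local_inverse {E : Type} [NormedAddCommGroup E] [NormedSpace ℝ E]
    [FiniteDimensional ℝ E] {Φ : E → E} (hΦ : ContDiff ℝ ∞ Φ) {x : E}
    (hinj : ∀ v, fderiv ℝ Φ x v = 0 → v = 0) :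
    ∃ e : OpenPartialHomeomorph E E, ⇑e = Φ ∧ x ∈ e.source ∧
      ∃ V, IsOpen V ∧ Φ x ∈ V ∧ V ⊆ e.target ∧ ContDiffOn ℝ ∞ e.symm V := by
  have : CompleteSpace E := FiniteDimensional.complete ℝ E
  have hker : Function.Injective (fderiv ℝ Φ x).toLinearMap :=
    (injective_iff_map_eq_zero (fderiv ℝ Φ x).toLinearMap).2 hinj
  set A : E ≃L[ℝ] E := (LinearEquiv.ofInjectiveEndo _ hker).toContinuousLinearEquiv with hA
  have hAd : (A : E →L[ℝ] E) = fderiv ℝ Φ x := by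
    ext v; rfl
  have hd : HasFDerivAt Φ (A : E →L[ℝ] E) x := by
    rw [hAd]
    exact (hΦ.differentiable (by simp) x).hasFDerivAt
  set e := hΦ.contDiffAt.toOpenPartialHomeomorph Φ hd (by simp)
  have hsrc : x ∈ e.source := hΦ.contDiffAt.mem_toOpenPartialHomeomorph_source hd (by simp)
  have heq : ⇑e = Φ := rfl
  have hopen : IsOpen {y : E | fderiv ℝ Φ y ∈ range ((↑) : (E ≃L[ℝ] E) → E →L[ℝ] E)} :=
    (ContinuousLinearEquiv.isOpen (𝕜 := ℝ) (E := E) (F := E)).preimage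
      (hΦ.continuous_fderiv (by simp))
  refine ⟨e, heq, hsrc, e.target ∩ e.symm ⁻¹' {y : E | fderiv ℝ Φ y ∈
    range ((↑) : (E ≃L[ℝ] E) → E →L[ℝ] E)}, e.symm.isOpen_inter_preimage hopen, ⟨e.map_source hsrc, ?_⟩,
    inter_subset_left, ?_⟩
  · change fderiv ℝ Φ (e.symm (e x)) ∈ range ((↑) : (E ≃L[ℝ] E) → E →L[ℝ] E)
    rw [e.left_inv hsrc]
    exact ⟨A, hAd⟩
  · rintro y ⟨hy, B, hB⟩
    refine (e.contDiffAt_symm hy (f₀' := B) ?_ ?_).contDiffWithinAt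
    · rw [hB, heq]
      exact (hΦ.differentiable (by simp) _).hasFDerivAt
    · rw [heq]
      exact hΦ.contDiffAt

/-- The coefficient `(2/L) ∫ (u - M) cos (kπx/L) dx` of a profile of length `L`, written as an
integral over the angle. -/
noncomputable def amplitude (y₀ L M : ℝ) (k : ℕ) (p : Param) : ℝ :=
  2 / L * ((p.2.1 - M) * (∫ t in (0 : ℝ)..k * π,
      cos (k * π * position y₀ p t / L) * slowness y₀ p (cos t))
    + p.2.2 * ∫ t in (0 : ℝ)..k * π,
      cos t * (cos (k * π * position y₀ p t / L) * slowness y₀ p (cos t)))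

theorem contDiff_amplitude_integrand {y₀ : ℝ} (hy : 0 < y₀) (L : ℝ) (k : ℕ) :
    ContDiff ℝ ∞ fun z : Param × ℝ =>
      cos (k * π * position y₀ z.1 z.2 / L) * slowness y₀ z.1 (cos z.2) :=
  (((contDiff_const.mul (contDiff_position hy)).div_const L).cos).mul (contDiff_slowness_cos hy)

theorem contDiff_length {y₀ : ℝ} (hy : 0 < y₀) (θ : ℝ) :
    ContDiff ℝ ∞ fun p => position y₀ p θ :=
  contDiff_parametric_integral (contDiff_slowness_cos hy) 0 θ

/-- The map whose fibre over `(L, 0, s)` is the point of the branch with cosine coefficient `s`. -/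
noncomputable def branchMap (y₀ L M : ℝ) (k : ℕ) (p : Param) : Param :=
  (position y₀ p (k * π), massDefect y₀ M k p, amplitude y₀ L M k p)

theorem contDiff_cos_integral {y₀ : ℝ} (hy : 0 < y₀) (k : ℕ) :
    ContDiff ℝ ∞ fun p : Param => ∫ t in (0 : ℝ)..k * π, cos t * slowness y₀ p (cos t) :=
  contDiff_parametric_integral (F := fun z : Param × ℝ => cos z.2 * slowness y₀ z.1 (cos z.2))
    (contDiff_snd.cos.mul (contDiff_slowness_cos hy)) _ _

theorem contDiff_amplitude_const {y₀ : ℝ} (hy : 0 < y₀) (L : ℝ) (k : ℕ) :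
    ContDiff ℝ ∞ fun p : Param => ∫ t in (0 : ℝ)..k * π,
      cos (k * π * position y₀ p t / L) * slowness y₀ p (cos t) :=
  contDiff_parametric_integral (contDiff_amplitude_integrand hy L k) _ _

theorem contDiff_amplitude_cos {y₀ : ℝ} (hy : 0 < y₀) (L : ℝ) (k : ℕ) :
    ContDiff ℝ ∞ fun p : Param => ∫ t in (0 : ℝ)..k * π,
      cos t * (cos (k * π * position y₀ p t / L) * slowness y₀ p (cos t)) :=
  contDiff_parametric_integral (F := fun z : Param × ℝ => cos z.2 *
      (cos (k * π * position y₀ z.1 z.2 / L) * slowness y₀ z.1 (cos z.2)))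
    (contDiff_snd.cos.mul (contDiff_amplitude_integrand hy L k)) _ _

theorem contDiff_branchMap {y₀ : ℝ} (hy : 0 < y₀) (L M : ℝ) (k : ℕ) :
    ContDiff ℝ ∞ (branchMap y₀ L M k) := by
  have h1 := contDiff_length hy (k * π)
  have h2 := contDiff_cos_integral hy k
  have h3 := contDiff_amplitude_const hy L k
  have h4 := contDiff_amplitude_cos hy L k
  unfold branchMap amplitude
  simp_rw [massDefect_eq hy]
  fun_prop

theorem position_at_constant {y₀ lam m : ℝ} (hy : 0 < y₀) (h : y₀ ≤ lam * (1 - 3 * m ^ 2))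
    (θ : ℝ) : position y₀ (lam, m, 0) θ = θ / √(lam * (1 - 3 * m ^ 2)) := by
  unfold position
  simp_rw [slowness_at_constant hy h]
  simp [div_eq_mul_inv]

/-- The derivative of `(m - M) I + ρ J` at a point where `m = M` and `ρ = 0` does not involve the
derivatives of `I` and `J`. -/
theorem fderiv_sub_mul_add_mul {p₀ : Param} {M : ℝ} {I J : Param → ℝ} (hm : p₀.2.1 = M)
    (hρ : p₀.2.2 = 0) (hI : ContDiff ℝ ∞ I) (hJ : ContDiff ℝ ∞ J) (v : Param) :
    fderiv ℝ (fun p : Param => (p.2.1 - M) * I p + p.2.2 * J p) p₀ v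
      = v.2.1 * I p₀ + v.2.2 * J p₀ := by
  have h1 : HasFDerivAt (fun p : Param => p.2.1 - M)
      ((ContinuousLinearMap.fst ℝ ℝ ℝ).comp (ContinuousLinearMap.snd ℝ ℝ (ℝ × ℝ))) p₀ :=
    ((ContinuousLinearMap.fst ℝ ℝ ℝ).comp
      (ContinuousLinearMap.snd ℝ ℝ (ℝ × ℝ))).hasFDerivAt.sub_const M
  have h2 : HasFDerivAt (fun p : Param => p.2.2)
      ((ContinuousLinearMap.snd ℝ ℝ ℝ).comp (ContinuousLinearMap.snd ℝ ℝ (ℝ × ℝ))) p₀ :=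
    ((ContinuousLinearMap.snd ℝ ℝ ℝ).comp (ContinuousLinearMap.snd ℝ ℝ (ℝ × ℝ))).hasFDerivAt
  have h := (h1.mul (hI.differentiable (by simp) p₀).hasFDerivAt).add
    (h2.mul (hJ.differentiable (by simp) p₀).hasFDerivAt)
  have h' := h.fderiv
  simp only [Pi.mul_def, Pi.add_def] at h'
  rw [h']
  simp [hm, hρ]
  ring

theorem integral_amplitude_cos_at_constant {y₀ L M lam₀ : ℝ} {k : ℕ} (hy : 0 < y₀) (hL : 0 < L)
    (hy₀ : y₀ < lam₀ * (1 - 3 * M ^ 2)) (hlen : k * π / √(lam₀ * (1 - 3 * M ^ 2)) = L) :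
    ∫ t in (0 : ℝ)..k * π, cos t * (cos (k * π * position y₀ (lam₀, M, 0) t / L)
      * slowness y₀ (lam₀, M, 0) (cos t)) = L / 2 := by
  have ha : 0 < √(lam₀ * (1 - 3 * M ^ 2)) := sqrt_pos.2 (hy.trans hy₀)
  have hkπ : √(lam₀ * (1 - 3 * M ^ 2)) * L = k * π := by rw [← hlen]; field_simp
  have harg : ∀ t, k * π * position y₀ (lam₀, M, 0) t / L = t := fun t => by
    rw [position_at_constant hy hy₀.le, ← hkπ]
    field_simp
  simp_rw [harg, slowness_at_constant hy hy₀.le, ← mul_assoc, ← sq]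
  rw [intervalIntegral.integral_mul_const, integral_cos_sq_nat_mul_pi, ← hkπ]
  field_simp

theorem fderiv_branchMap_injective {y₀ L M lam₀ : ℝ} {k : ℕ} (hy : 0 < y₀) (hL : 0 < L)
    (hy₀ : y₀ < lam₀ * (1 - 3 * M ^ 2)) (hM : 0 < 1 - 3 * M ^ 2)
    (hlen : k * π / √(lam₀ * (1 - 3 * M ^ 2)) = L) (v : Param)
    (hv : fderiv ℝ (branchMap y₀ L M k) (lam₀, M, 0) v = 0) : v = 0 := by
  set p₀ : Param := (lam₀, M, 0) with hp₀
  have hpos : 0 < lam₀ * (1 - 3 * M ^ 2) := hy.trans hy₀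
  have ha : 0 < √(lam₀ * (1 - 3 * M ^ 2)) := sqrt_pos.2 hpos
  have hkπ : √(lam₀ * (1 - 3 * M ^ 2)) * L = k * π := by rw [← hlen]; field_simp
  have h1 := contDiff_length hy (k * π)
  have h2 := contDiff_cos_integral hy k
  have h3 := contDiff_amplitude_const hy L k
  have h4 := contDiff_amplitude_cos hy L k
  have hL0 : position y₀ p₀ (k * π) = L := by
    rw [hp₀, position_at_constant hy hy₀.le, hlen]
  have hC0 : ∫ t in (0 : ℝ)..k * π, cos t * slowness y₀ p₀ (cos t) = 0 := by
    simp_rw [hp₀, slowness_at_constant hy hy₀.le]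
    rw [intervalIntegral.integral_mul_const, integral_cos_nat_mul_pi, zero_mul]
  have harg : ∀ t, k * π * position y₀ p₀ t / L = t := fun t => by
    rw [hp₀, position_at_constant hy hy₀.le, ← hkπ]
    field_simp
  have hI0 : ∫ t in (0 : ℝ)..k * π,
      cos (k * π * position y₀ p₀ t / L) * slowness y₀ p₀ (cos t) = 0 := by
    simp_rw [harg]
    exact hC0
  have hJ0 := integral_amplitude_cos_at_constant hy hL hy₀ hlen
  have hA : ContDiff ℝ ∞ (massDefect y₀ M k) := by
    simp_rw [show massDefect y₀ M k = _ from funext fun p => massDefect_eq hy M k p]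
    fun_prop
  have hB : ContDiff ℝ ∞ (amplitude y₀ L M k) := by
    unfold amplitude
    fun_prop
  have hΦ : fderiv ℝ (branchMap y₀ L M k) p₀ v = (fderiv ℝ (fun p => position y₀ p (k * π)) p₀ v,
      fderiv ℝ (massDefect y₀ M k) p₀ v, fderiv ℝ (amplitude y₀ L M k) p₀ v) := by
    have h := (h1.differentiable (by simp) p₀).hasFDerivAt.prodMk
      ((hA.differentiable (by simp) p₀).hasFDerivAt.prodMk
        (hB.differentiable (by simp) p₀).hasFDerivAt)
    exact congrArg (fun T => T v) h.fderiv
  rw [hΦ, Prod.mk_eq_zero, Prod.mk_eq_zero] at hv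
  obtain ⟨hv1, hv2, hv3⟩ := hv
  -- Mass defect and cosine coefficient vanish to first order except in `m` and `ρ` respectively;
  -- the remaining direction is that of `λ`, along which the length is explicit.
  have hv2' : v.2.1 = 0 := by
    rw [show massDefect y₀ M k = _ from funext fun p => massDefect_eq hy M k p,
      fderiv_sub_mul_add_mul (p₀ := p₀) (M := M) rfl rfl h1 h2, hL0, hC0, mul_zero, add_zero] at hv2
    exact (mul_eq_zero.1 hv2).resolve_right hL.ne'
  have hv3' : v.2.2 = 0 := by
    have h5 := fderiv_sub_mul_add_mul (p₀ := p₀) (M := M) rfl rfl h3 h4 v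
    have hin : ContDiff ℝ ∞ fun p : Param => (p.2.1 - M) * (∫ t in (0 : ℝ)..k * π,
          cos (k * π * position y₀ p t / L) * slowness y₀ p (cos t))
        + p.2.2 * ∫ t in (0 : ℝ)..k * π,
          cos t * (cos (k * π * position y₀ p t / L) * slowness y₀ p (cos t)) := by fun_prop
    unfold amplitude at hv3
    rw [fderiv_const_mul (hin.differentiable (by simp) p₀)] at hv3
    simp only [smul_apply, smul_eq_mul] at hv3
    rw [h5, hI0, hJ0, mul_zero, zero_add] at hv3
    have : 2 / L * (v.2.2 * (L / 2)) = v.2.2 := by field_simp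
    rwa [this] at hv3
  have hv1' : v.1 = 0 := by
    have h5 : HasDerivAt (fun t : ℝ => position y₀ (t, M, 0) (k * π))
        (fderiv ℝ (fun p => position y₀ p (k * π)) p₀ (1, 0, 0)) lam₀ :=
      (h1.differentiable (by simp) p₀).hasFDerivAt.comp_hasDerivAt lam₀
        (f := fun t => ((t, M, 0) : Param))
        ((hasDerivAt_id lam₀).prodMk (hasDerivAt_const lam₀ ((M, 0) : ℝ × ℝ)))
    have h6 : HasDerivAt (fun t : ℝ => k * π / √(t * (1 - 3 * M ^ 2)))
        (-(k * π * ((1 - 3 * M ^ 2) / (2 * √(lam₀ * (1 - 3 * M ^ 2)))))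
          / √(lam₀ * (1 - 3 * M ^ 2)) ^ 2) lam₀ := by
      have h7 : HasDerivAt (fun t : ℝ => t * (1 - 3 * M ^ 2)) (1 - 3 * M ^ 2) lam₀ := by
        simpa using (hasDerivAt_id lam₀).mul_const (1 - 3 * M ^ 2)
      refine ((hasDerivAt_const lam₀ (k * π)).div (h7.sqrt hpos.ne') ha.ne').congr_deriv ?_
      ring
    have h7 : (fun t : ℝ => position y₀ (t, M, 0) (k * π))
        =ᶠ[𝓝 lam₀] fun t : ℝ => k * π / √(t * (1 - 3 * M ^ 2)) := by
      have hc : ContinuousAt (fun t : ℝ => t * (1 - 3 * M ^ 2)) lam₀ := by fun_prop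
      filter_upwards [hc.eventually_const_lt hy₀] with t ht
      exact position_at_constant hy ht.le _
    have h8 := (h6.congr_of_eventuallyEq h7).unique h5
    have hvv : v = v.1 • ((1, 0, 0) : Param) := by
      ext <;> simp [hv2', hv3']
    rw [hvv, map_smul, ← h8, smul_eq_mul] at hv1
    refine (mul_eq_zero.1 hv1).resolve_right ?_
    rw [← hkπ]
    have : 0 < √(lam₀ * (1 - 3 * M ^ 2)) * L * ((1 - 3 * M ^ 2) / (2 * √(lam₀ * (1 - 3 * M ^ 2))))
      / √(lam₀ * (1 - 3 * M ^ 2)) ^ 2 := by positivity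
    rw [neg_div]
    exact (neg_neg_of_pos this).ne
  exact Prod.ext hv1' (Prod.ext hv2' hv3')

/-! ### The bifurcating branch and its curvature -/

/-- The limit of `(λ - λ_k) / s²` along the branch, which is half of `Λ''(0)`. -/
noncomputable def curvature (M lam : ℝ) : ℝ :=
  3 * lam / 4 * ((1 - 5 * M ^ 2) / (1 - 3 * M ^ 2) ^ 2 - lam * (1 - 3 * M ^ 2) / 2)

theorem eventually_frequency {y₀ lam₀ M : ℝ} (h : y₀ < lam₀ * (1 - 3 * M ^ 2)) :
    ∀ᶠ p in 𝓝 ((lam₀, M, 0) : Param), y₀ ≤ p.1 * (1 - 3 * p.2.1 ^ 2) := by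
  have hc : ContinuousAt (fun p : Param => p.1 * (1 - 3 * p.2.1 ^ 2)) (lam₀, M, 0) := by fun_prop
  filter_upwards [hc.eventually_const_lt h] with p hp using hp.le

theorem tendsto_branch_mean {ι : Type*} {l : Filter ι} {γ : ι → Param} {y₀ L M lam₀ : ℝ} {k : ℕ}
    (hy : 0 < y₀) (hL : 0 < L) (hy₀ : y₀ < lam₀ * (1 - 3 * M ^ 2))
    (hlen : k * π / √(lam₀ * (1 - 3 * M ^ 2)) = L)
    (hγ : Tendsto γ l (𝓝 (lam₀, M, 0)))
    (hev : ∀ᶠ i in l, position y₀ (γ i) (k * π) = L ∧ massDefect y₀ M k (γ i) = 0 ∧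
      (γ i).2.2 ≠ 0) :
    Tendsto (fun i => ((γ i).2.1 - M) / (γ i).2.2 ^ 2) l
      (𝓝 (-(lam₀ * M / (2 * (lam₀ * (1 - 3 * M ^ 2)))))) := by
  have hpos : 0 < lam₀ * (1 - 3 * M ^ 2) := hy.trans hy₀
  have ha : 0 < √(lam₀ * (1 - 3 * M ^ 2)) := sqrt_pos.2 hpos
  have hs : √(lam₀ * (1 - 3 * M ^ 2)) ^ 2 = lam₀ * (1 - 3 * M ^ 2) := sq_sqrt hpos.le
  have h1 : Tendsto (fun i => -(massCoeff y₀ k (γ i) / L)) l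
      (𝓝 (-(massCoeff y₀ k (lam₀, M, 0) / L))) :=
    ((((continuous_massCoeff hy k).tendsto _).comp hγ).div_const L).neg
  have h2 : massCoeff y₀ k (lam₀, M, 0) / L = lam₀ * M / (2 * (lam₀ * (1 - 3 * M ^ 2))) := by
    have hk : (k : ℝ) * π = √(lam₀ * (1 - 3 * M ^ 2)) * L := by rw [← hlen]; field_simp
    unfold massCoeff frequency
    simp only [zero_mul, add_zero]
    rw [clip_of_le hy hy₀.le, hk]
    generalize √(lam₀ * (1 - 3 * M ^ 2)) = a at *
    rw [← hs]
    field_simp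
  rw [h2] at h1
  refine h1.congr' ?_
  filter_upwards [hev, hγ.eventually (eventually_regular hy₀), hγ.eventually
    (eventually_frequency hy₀)] with i hi hr hf
  obtain ⟨hi1, hi2, hi3⟩ := hi
  have h3 := mass_expansion hy hr hf M k
  rw [hi1, hi2] at h3
  field_simp
  linarith

theorem tendsto_branch_parameter {ι : Type*} {l : Filter ι} {γ : ι → Param} {y₀ L M lam₀ : ℝ}
    {k : ℕ} (hy : 0 < y₀) (hL : 0 < L) (hy₀ : y₀ < lam₀ * (1 - 3 * M ^ 2))
    (hM : 0 < 1 - 3 * M ^ 2) (hlen : k * π / √(lam₀ * (1 - 3 * M ^ 2)) = L)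
    (hγ : Tendsto γ l (𝓝 (lam₀, M, 0)))
    (hev : ∀ᶠ i in l, position y₀ (γ i) (k * π) = L ∧ massDefect y₀ M k (γ i) = 0 ∧
      (γ i).2.2 ≠ 0) :
    Tendsto (fun i => ((γ i).1 - lam₀) / (γ i).2.2 ^ 2) l (𝓝 (curvature M lam₀)) := by
  have hpos : 0 < lam₀ * (1 - 3 * M ^ 2) := hy.trans hy₀
  have hlam : 0 < lam₀ := pos_of_mul_pos_left hpos hM.le
  have hs : √(lam₀ * (1 - 3 * M ^ 2)) ^ 2 = lam₀ * (1 - 3 * M ^ 2) := sq_sqrt hpos.le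
  have ha : 0 < √(lam₀ * (1 - 3 * M ^ 2)) := sqrt_pos.2 hpos
  have hk : √(lam₀ * (1 - 3 * M ^ 2)) * L = k * π := by rw [← hlen]; field_simp
  have hm := tendsto_branch_mean hy hL hy₀ hlen hγ hev
  have hγ1 : Tendsto (fun i => (γ i).1) l (𝓝 lam₀) := (continuous_fst.tendsto _).comp hγ
  have hγ2 : Tendsto (fun i => (γ i).2.1) l (𝓝 M) :=
    ((continuous_fst.comp continuous_snd).tendsto _).comp hγ
  have hγ3 : Tendsto (fun i => (γ i).2.2) l (𝓝 0) :=
    ((continuous_snd.comp continuous_snd).tendsto _).comp hγ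
  have hJ := ((continuous_lengthCoeff hy k).tendsto (lam₀, M, 0)).comp hγ
  rw [lengthCoeff_at_constant hy hy₀.le, hlen] at hJ
  have hlim := (hγ1.mul ((((hγ2.add_const M).const_mul (3 * L ^ 2)).mul hm).add
    (((hγ2.pow 2).const_mul 3).const_sub 1 |>.mul
      ((hJ.const_mul (2 * L)).sub ((hγ3.pow 2).mul (hJ.pow 2)))))).div_const
      ((1 - 3 * M ^ 2) * L ^ 2)
  have hval : lam₀ * (3 * L ^ 2 * (M + M) * -(lam₀ * M / (2 * (lam₀ * (1 - 3 * M ^ 2)))) +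
      (1 - 3 * M ^ 2) * (2 * L * (L * (3 * lam₀ / (8 * (lam₀ * (1 - 3 * M ^ 2)))
        - 3 * (lam₀ * (1 - 3 * M ^ 2)) / 16
        + 3 * lam₀ ^ 2 * M ^ 2 / (4 * (lam₀ * (1 - 3 * M ^ 2)) ^ 2))) -
        0 ^ 2 * (L * (3 * lam₀ / (8 * (lam₀ * (1 - 3 * M ^ 2)))
        - 3 * (lam₀ * (1 - 3 * M ^ 2)) / 16
        + 3 * lam₀ ^ 2 * M ^ 2 / (4 * (lam₀ * (1 - 3 * M ^ 2)) ^ 2))) ^ 2)) /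
      ((1 - 3 * M ^ 2) * L ^ 2) = curvature M lam₀ := by
    unfold curvature
    have h1 : 1 - 5 * M ^ 2 = (1 - 3 * M ^ 2) - 2 * M ^ 2 := by ring
    rw [h1]
    generalize 1 - 3 * M ^ 2 = F at *
    field_simp
    ring
  rw [hval] at hlim
  refine hlim.congr' ?_
  filter_upwards [hev, hγ.eventually (eventually_regular hy₀), hγ.eventually
    (eventually_frequency hy₀)] with i hi hr hf
  obtain ⟨hi1, hi2, hi3⟩ := hi
  have h3 := length_expansion hy hr hf k
  have h4 := frequency_sq hy hf
  have h5 := frequency_pos hy (γ i)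
  rw [hi1] at h3
  simp only [Function.comp_def]
  generalize lengthCoeff y₀ k (γ i) = J at *
  generalize frequency y₀ (γ i) = a at *
  generalize (γ i).2.2 = ρ at *
  generalize (γ i).2.1 = m at *
  generalize (γ i).1 = lam at *
  -- Eliminating `a` between the length equation and `a² = λ (1 - 3m²)` leaves a relation that is
  -- linear in `λ`.
  have h6 : a * (L - ρ ^ 2 * J) = k * π := by
    rw [h3]; field_simp; ring
  have h7 : lam * (1 - 3 * m ^ 2) * (L - ρ ^ 2 * J) ^ 2 = lam₀ * (1 - 3 * M ^ 2) * L ^ 2 := by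
    rw [← h4, ← hs, ← mul_pow, ← mul_pow, h6, hk]
  field_simp
  linear_combination (-1 : ℝ) * h7

theorem tendsto_branch_amplitude {ι : Type*} {l : Filter ι} {γ : ι → Param} {y₀ L M lam₀ : ℝ}
    {k : ℕ} (hy : 0 < y₀) (hL : 0 < L) (hy₀ : y₀ < lam₀ * (1 - 3 * M ^ 2))
    (hlen : k * π / √(lam₀ * (1 - 3 * M ^ 2)) = L)
    (hγ : Tendsto γ l (𝓝 (lam₀, M, 0)))
    (hev : ∀ᶠ i in l, position y₀ (γ i) (k * π) = L ∧ massDefect y₀ M k (γ i) = 0 ∧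
      (γ i).2.2 ≠ 0) :
    Tendsto (fun i => amplitude y₀ L M k (γ i) / (γ i).2.2) l (𝓝 1) := by
  have hm := tendsto_branch_mean hy hL hy₀ hlen hγ hev
  have hγ3 : Tendsto (fun i => (γ i).2.2) l (𝓝 0) :=
    ((continuous_snd.comp continuous_snd).tendsto _).comp hγ
  have hI := ((contDiff_amplitude_const hy L k).continuous.tendsto (lam₀, M, 0)).comp hγ
  have hJ := ((contDiff_amplitude_cos hy L k).continuous.tendsto (lam₀, M, 0)).comp hγ
  rw [integral_amplitude_cos_at_constant hy hL hy₀ hlen] at hJ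
  have h := (((hm.mul hγ3).mul hI).add hJ).const_mul (2 / L)
  rw [mul_zero, zero_mul, zero_add, show 2 / L * (L / 2) = 1 by field_simp] at h
  refine h.congr' ?_
  filter_upwards [hev] with i hi
  have hi3 := hi.2.2
  unfold amplitude
  simp only [Function.comp_def]
  field_simp

theorem integral_profile_mul_cos {y₀ : ℝ} (hy : 0 < y₀) {L : ℝ} (hL : 0 < L) (M : ℝ) {k : ℕ}
    {p : Param} (hlen : position y₀ p (k * π) = L) :
    ∫ x in (0 : ℝ)..L, (profile y₀ p x - M) * cos (k * π * x / L)
      = L / 2 * amplitude y₀ L M k p := by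
  have h := integral_comp_angle hy p
    (G := fun t x => (p.2.1 + p.2.2 * cos t - M) * cos (k * π * x / L)) (by fun_prop) (k * π)
  rw [hlen] at h
  have hτ := continuous_slowness_cos hy p
  have hX := continuous_position hy p
  unfold profile
  rw [h]
  have h3 : ∀ t, (p.2.1 + p.2.2 * cos t - M) * cos (k * π * position y₀ p t / L)
      * slowness y₀ p (cos t)
      = (p.2.1 - M) * (cos (k * π * position y₀ p t / L) * slowness y₀ p (cos t))
        + p.2.2 * (cos t * (cos (k * π * position y₀ p t / L) * slowness y₀ p (cos t))) :=
    fun t => by ring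
  simp_rw [h3]
  rw [intervalIntegral.integral_add (Continuous.intervalIntegrable (by fun_prop) _ _)
        (Continuous.intervalIntegrable (by fun_prop) _ _),
      intervalIntegral.integral_const_mul, intervalIntegral.integral_const_mul]
  unfold amplitude
  field_simp

/-- The curve of profiles of length `L` and mean `M` through the constant solution, parametrized by
the cosine coefficient, and its local uniqueness. -/
theorem exists_branch {y₀ L M lam₀ : ℝ} {k : ℕ} (hy : 0 < y₀) (hL : 0 < L)
    (hy₀ : y₀ < lam₀ * (1 - 3 * M ^ 2)) (hM : 0 < 1 - 3 * M ^ 2)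
    (hlen : k * π / √(lam₀ * (1 - 3 * M ^ 2)) = L) :
    ∃ δ > 0, ∃ γ : ℝ → Param, ContDiffOn ℝ ∞ γ (Ioo (-δ) δ) ∧ γ 0 = (lam₀, M, 0) ∧
      (∀ s ∈ Ioo (-δ) δ, Regular y₀ (γ s) ∧ position y₀ (γ s) (k * π) = L ∧
        massDefect y₀ M k (γ s) = 0 ∧ amplitude y₀ L M k (γ s) = s) ∧
      ∃ N ∈ 𝓝 ((lam₀, M, 0) : Param), ∀ p ∈ N, position y₀ p (k * π) = L →
        massDefect y₀ M k p = 0 →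
        amplitude y₀ L M k p ∈ Ioo (-δ) δ ∧ p = γ (amplitude y₀ L M k p) := by
  have hΦ := contDiff_branchMap hy L M k
  obtain ⟨e, he, hsrc, V, hVo, hxV, hVt, hVs⟩ := exists_smooth_local_inverse hΦ
    (fderiv_branchMap_injective hy hL hy₀ hM hlen)
  have hbase : branchMap y₀ L M k (lam₀, M, 0) = (L, 0, 0) := by
    unfold branchMap
    rw [massDefect_eq hy, position_at_constant hy hy₀.le, hlen]
    simp [amplitude]
  rw [hbase] at hxV
  have hcurve : Continuous fun s : ℝ => ((L, 0, s) : Param) := by fun_prop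
  have hsymm0 : e.symm (L, 0, 0) = (lam₀, M, 0) := by
    rw [← hbase, ← he, e.left_inv hsrc]
  have hcont : ContinuousAt (fun s : ℝ => e.symm (L, 0, s)) 0 :=
    ContinuousAt.comp (f := fun s : ℝ => ((L, 0, s) : Param)) (g := e.symm)
      ((hVs.continuousOn).continuousAt (hVo.mem_nhds hxV)) hcurve.continuousAt
  have hreg : ∀ᶠ s in 𝓝 (0 : ℝ), Regular y₀ (e.symm (L, 0, s)) := by
    refine hcont.eventually ?_
    simp only [hsymm0]
    exact eventually_regular hy₀
  have hV0 : ∀ᶠ s in 𝓝 (0 : ℝ), ((L, 0, s) : Param) ∈ V :=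
    hcurve.continuousAt.eventually_mem (hVo.mem_nhds hxV)
  obtain ⟨δ, hδ, hball⟩ := Metric.eventually_nhds_iff.1 (hreg.and hV0)
  have hball' : ∀ s ∈ Ioo (-δ) δ, Regular y₀ (e.symm (L, 0, s)) ∧ ((L, 0, s) : Param) ∈ V :=
    fun s hs => hball (by rw [Real.dist_eq, sub_zero, abs_lt]; exact hs)
  refine ⟨δ, hδ, fun s => e.symm (L, 0, s), ?_, hsymm0, fun s hs => ?_, ?_⟩
  · have h1 : ContDiff ℝ ∞ fun s : ℝ => ((L, 0, s) : Param) := by fun_prop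
    exact hVs.comp h1.contDiffOn fun s hs => (hball' s hs).2
  · have h1 := e.right_inv (hVt (hball' s hs).2)
    rw [he] at h1
    simp only [branchMap, Prod.mk.injEq] at h1
    exact ⟨(hball' s hs).1, h1⟩
  · have hamp : ContinuousAt (amplitude y₀ L M k) (lam₀, M, 0) :=
      ((continuous_snd.comp continuous_snd).comp hΦ.continuous).continuousAt
    have hamp0 : amplitude y₀ L M k (lam₀, M, 0) = 0 := by simp [amplitude]
    refine ⟨e.source ∩ {p | amplitude y₀ L M k p ∈ Ioo (-δ) δ},
      inter_mem (e.open_source.mem_nhds hsrc) (hamp.eventually_mem (Ioo_mem_nhds ?_ ?_)), ?_⟩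
    · rw [hamp0]; linarith
    · rw [hamp0]; exact hδ
    · rintro p ⟨hp, hps⟩ h1 h2
      refine ⟨hps, ?_⟩
      have h3 := e.left_inv hp
      rw [he] at h3
      simp only [branchMap, h1, h2] at h3
      exact h3.symm

/-! ### Closeness in C² and bifurcation values -/

theorem eventually_forall_abs_sub_lt {g : ℝ → ℝ → ℝ} {s₀ L η : ℝ}
    (h : ∀ x ∈ Icc 0 L, ContinuousAt (fun z : ℝ × ℝ => g z.1 z.2) (s₀, x)) (hη : 0 < η) :
    ∀ᶠ s in 𝓝 s₀, ∀ x ∈ Icc 0 L, |g s x - g s₀ x| < η := by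
  refine isCompact_Icc.eventually_forall_of_forall_eventually
    (P := fun s x => |g s x - g s₀ x| < η) fun x hx => ?_
  have h1 : ContinuousAt (fun z : ℝ × ℝ => g s₀ z.2) (s₀, x) :=
    ContinuousAt.comp (f := fun z : ℝ × ℝ => (s₀, z.2)) (g := fun z : ℝ × ℝ => g z.1 z.2) (h x hx)
      (by fun_prop)
  have h2 := ((h x hx).sub h1).abs
  exact h2.eventually_lt_const (by simpa using hη)

/-- Functions `α + β cos θ`, with coefficients and parameters depending continuously on `s`, depend
continuously on `s` in the `C²` sense. -/
theorem eventually_C2Close {y₀ L η s₀ : ℝ} (hy : 0 < y₀) {α β : ℝ → ℝ} {γ : ℝ → Param}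
    (hα : ContinuousAt α s₀) (hβ : ContinuousAt β s₀) (hγ : ContinuousAt γ s₀) (hη : 0 < η) :
    ∀ᶠ s in 𝓝 s₀, C2Close L η (fun x => α s + β s * cos (angle y₀ (γ s) x))
      (fun x => α s₀ + β s₀ * cos (angle y₀ (γ s₀) x)) := by
  have hd1 : ∀ s, deriv (fun x => α s + β s * cos (angle y₀ (γ s) x)) = _ := fun s => funext fun x =>
    (((hasDerivAt_cos_angle hy (γ s) x).const_mul (β s)).const_add (α s)).deriv
  have hd2 : ∀ s, deriv (fun x => β s * (-sin (angle y₀ (γ s) x)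
      * (slowness y₀ (γ s) (cos (angle y₀ (γ s) x)))⁻¹)) = _ := fun s => funext fun x =>
    ((hasDerivAt_deriv_cos_angle hy (γ s) x).const_mul (β s)).deriv
  have hfst : ∀ x : ℝ, ContinuousAt (fun z : ℝ × ℝ => z.1) (s₀, x) := fun x => continuousAt_fst
  have hα' : ∀ x : ℝ, ContinuousAt (fun z : ℝ × ℝ => α z.1) (s₀, x) := fun x =>
    ContinuousAt.comp (g := α) (f := fun z : ℝ × ℝ => z.1) hα (hfst x)
  have hβ' : ∀ x : ℝ, ContinuousAt (fun z : ℝ × ℝ => β z.1) (s₀, x) := fun x =>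
    ContinuousAt.comp (g := β) (f := fun z : ℝ × ℝ => z.1) hβ (hfst x)
  have hγ' : ∀ x : ℝ, ContinuousAt (fun z : ℝ × ℝ => γ z.1) (s₀, x) := fun x =>
    ContinuousAt.comp (g := γ) (f := fun z : ℝ × ℝ => z.1) hγ (hfst x)
  have hΘ : ∀ x : ℝ, ContinuousAt (fun z : ℝ × ℝ => angle y₀ (γ z.1) z.2) (s₀, x) := fun x =>
    ContinuousAt.comp (g := fun w : Param × ℝ => angle y₀ w.1 w.2)
      (f := fun z : ℝ × ℝ => (γ z.1, z.2)) (continuous_angle hy).continuousAt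
      ((hγ' x).prodMk continuousAt_snd)
  have hτ : ∀ x : ℝ, ContinuousAt (fun z : ℝ × ℝ =>
      (slowness y₀ (γ z.1) (cos (angle y₀ (γ z.1) z.2)))⁻¹) (s₀, x) := fun x =>
    ContinuousAt.comp (g := fun w : Param × ℝ => (slowness y₀ w.1 (cos w.2))⁻¹)
      (f := fun z : ℝ × ℝ => (γ z.1, angle y₀ (γ z.1) z.2))
      (contDiff_angularSpeed hy).continuous.continuousAt ((hγ' x).prodMk (hΘ x))
  have hτ' : ∀ x : ℝ, ContinuousAt (fun z : ℝ × ℝ =>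
      angularSpeedDeriv y₀ (γ z.1) (angle y₀ (γ z.1) z.2)) (s₀, x) := fun x =>
    ContinuousAt.comp (g := fun w : Param × ℝ => angularSpeedDeriv y₀ w.1 w.2)
      (f := fun z : ℝ × ℝ => (γ z.1, angle y₀ (γ z.1) z.2))
      (continuous_angularSpeedDeriv hy).continuousAt ((hγ' x).prodMk (hΘ x))
  have hcos : ∀ x : ℝ, ContinuousAt (fun z : ℝ × ℝ => cos (angle y₀ (γ z.1) z.2)) (s₀, x) :=
    fun x => continuous_cos.continuousAt.comp (hΘ x)
  have hsin : ∀ x : ℝ, ContinuousAt (fun z : ℝ × ℝ => sin (angle y₀ (γ z.1) z.2)) (s₀, x) :=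
    fun x => continuous_sin.continuousAt.comp (hΘ x)
  have h0 := eventually_forall_abs_sub_lt (L := L) (s₀ := s₀)
    (g := fun s x => α s + β s * cos (angle y₀ (γ s) x))
    (fun x _ => (hα' x).add ((hβ' x).mul (hcos x))) hη
  have h1 := eventually_forall_abs_sub_lt (L := L) (s₀ := s₀)
    (g := fun s x => β s * (-sin (angle y₀ (γ s) x)
      * (slowness y₀ (γ s) (cos (angle y₀ (γ s) x)))⁻¹))
    (fun x _ => (hβ' x).mul ((hsin x).neg.mul (hτ x))) hη
  have h2 := eventually_forall_abs_sub_lt (L := L) (s₀ := s₀)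
    (g := fun s x => β s * (-(cos (angle y₀ (γ s) x)
      * (slowness y₀ (γ s) (cos (angle y₀ (γ s) x)))⁻¹)
          * (slowness y₀ (γ s) (cos (angle y₀ (γ s) x)))⁻¹
        + -sin (angle y₀ (γ s) x) * (angularSpeedDeriv y₀ (γ s) (angle y₀ (γ s) x)
          * (slowness y₀ (γ s) (cos (angle y₀ (γ s) x)))⁻¹)))
    (fun x _ => (hβ' x).mul ((((hcos x).mul (hτ x)).neg.mul (hτ x)).add
      ((hsin x).neg.mul ((hτ' x).mul (hτ x))))) hη
  filter_upwards [h0, h1, h2] with s hs0 hs1 hs2 x hx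
  have hx' := Ioo_subset_Icc_self hx
  refine ⟨hs0 x hx', ?_, ?_⟩
  · rw [hd1, hd1]
    exact hs1 x hx'
  · rw [hd1, hd1, hd2, hd2]
    exact hs2 x hx'

theorem C2Close.sub_right {L η : ℝ} {u w g : ℝ → ℝ} (h : C2Close L η u w) (hu : ContDiff ℝ 2 u)
    (hw : ContDiff ℝ 2 w) (hg : ContDiff ℝ 2 g) :
    C2Close L η (fun x => u x - g x) (fun x => w x - g x) := by
  have key : ∀ v : ℝ → ℝ, ContDiff ℝ 2 v →
      deriv (fun x => v x - g x) = fun x => deriv v x - deriv g x := fun v hv => funext fun x =>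
    deriv_sub (hv.differentiable two_ne_zero x) (hg.differentiable two_ne_zero x)
  have hdiff : ∀ v : ℝ → ℝ, ContDiff ℝ 2 v → Differentiable ℝ (deriv v) := fun v hv =>
    ((contDiff_succ_iff_deriv (n := 1)).1 (by simpa [one_add_one_eq_two] using hv)).2.2.differentiable
      one_ne_zero
  have key2 : ∀ v : ℝ → ℝ, ContDiff ℝ 2 v → deriv (deriv fun x => v x - g x)
      = fun x => deriv (deriv v) x - deriv (deriv g) x := fun v hv => by
    rw [key v hv]
    exact funext fun x => deriv_sub (hdiff v hv x) (hdiff g hg x)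
  intro x hx
  obtain ⟨h0, h1, h2⟩ := h x hx
  rw [key2 u hu, key2 w hw, key u hu, key w hw]
  simp only [sub_sub_sub_cancel_right]
  exact ⟨h0, h1, h2⟩

theorem abs_position_sub_le {y₀ T η θ : ℝ} (hy : 0 < y₀) {p : Param} (hθ : 0 ≤ θ)
    (h : ∀ c ∈ Icc (-1 : ℝ) 1, |slowness y₀ p c - T| ≤ η) :
    |position y₀ p θ - θ * T| ≤ η * θ := by
  have h1 := intervalIntegral.norm_integral_le_of_norm_le_const (a := 0) (b := θ) (C := η)
    (f := fun t => slowness y₀ p (cos t) - T) (fun t _ => h _ ⟨neg_one_le_cos t, cos_le_one t⟩)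
  rw [intervalIntegral.integral_sub ((continuous_slowness_cos hy p).intervalIntegrable _ _)
    intervalIntegrable_const, intervalIntegral.integral_const, sub_zero, smul_eq_mul,
    abs_of_nonneg hθ] at h1
  exact h1

theorem eventually_slowness_near {y₀ lam₀ M η : ℝ} (hy : 0 < y₀)
    (hy₀ : y₀ < lam₀ * (1 - 3 * M ^ 2)) (hη : 0 < η) :
    ∀ᶠ p in 𝓝 ((lam₀, M, 0) : Param), ∀ c ∈ Icc (-1 : ℝ) 1,
      |slowness y₀ p c - (√(lam₀ * (1 - 3 * M ^ 2)))⁻¹| ≤ η := by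
  refine eventually_forall_Icc
    (P := fun p c => |slowness y₀ p c - (√(lam₀ * (1 - 3 * M ^ 2)))⁻¹| ≤ η) fun c _ => ?_
  have hc : Continuous fun z : Param × ℝ =>
      |slowness y₀ z.1 z.2 - (√(lam₀ * (1 - 3 * M ^ 2)))⁻¹| :=
    ((contDiff_slowness hy).continuous.sub continuous_const).abs
  have h := (hc.continuousAt (x := ((lam₀, M, 0), c))).eventually_lt_const (u := η)
    (by simpa [slowness_at_constant hy hy₀.le] using hη)
  filter_upwards [h] with z hz using hz.le

theorem length_eq_of_bifurcationValue {L M lam₀ : ℝ} {k : ℕ} (hL : 0 < L) (hM : 0 < 1 - 3 * M ^ 2)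
    (hlam : lam₀ = bifurcationValue L M k) (hk : 1 ≤ k) :
    k * π / √(lam₀ * (1 - 3 * M ^ 2)) = L := by
  have hk0 : (0 : ℝ) < k := by exact_mod_cast hk
  have h1 : lam₀ * (1 - 3 * M ^ 2) = (k * π / L) ^ 2 := by
    rw [hlam]
    unfold bifurcationValue
    field_simp
  rw [h1, sqrt_sq (by positivity)]
  field_simp

/-- Necessity: the number `L √(λ₀ (1 - 3M²)) / π` is arbitrarily well approximated by positive
integers in the relative sense, so it is one. -/
theorem exists_bifurcationValue_eq {L M lam₀ : ℝ} (hL : 0 < L) (hM : 0 < 1 - 3 * M ^ 2)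
    (hlam : 0 < lam₀) (hbif : IsBifurcationPoint L M lam₀) :
    ∃ k : ℕ, 1 ≤ k ∧ lam₀ = bifurcationValue L M k := by
  have hpos : 0 < lam₀ * (1 - 3 * M ^ 2) := mul_pos hlam hM
  have hs : √(lam₀ * (1 - 3 * M ^ 2)) ^ 2 = lam₀ * (1 - 3 * M ^ 2) := sq_sqrt hpos.le
  set a := √(lam₀ * (1 - 3 * M ^ 2)) with ha'
  have ha : 0 < a := sqrt_pos.2 hpos
  have hy : 0 < lam₀ * (1 - 3 * M ^ 2) / 2 := half_pos hpos
  have hy₀ : lam₀ * (1 - 3 * M ^ 2) / 2 < lam₀ * (1 - 3 * M ^ 2) := half_lt_self hpos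
  set X := L * a / π with hX
  have hX0 : 0 < X := by positivity
  have hnear : ∀ η > 0, ∃ k : ℕ, 1 ≤ k ∧ |X - k| ≤ η * k := by
    intro η hη
    obtain ⟨ε, hε, H⟩ := solution_near_constant hy hL hM hy₀
      (eventually_slowness_near hy hy₀ (div_pos hη ha))
    obtain ⟨lam, u, h1, h2, h3, h4⟩ := hbif ε hε
    obtain ⟨p, hpN, -, -, -, k, hk, hlen, -⟩ := H lam u h1 h2 h3 h4
    refine ⟨k, hk, ?_⟩
    have h5 := abs_position_sub_le hy (θ := k * π) (by positivity) hpN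
    rw [hlen] at h5
    have h6 : X - k = a / π * (L - k * π * a⁻¹) := by
      rw [hX]; field_simp
    rw [h6, abs_mul, abs_of_pos (by positivity : 0 < a / π)]
    calc a / π * |L - k * π * a⁻¹| ≤ a / π * (η / a * (k * π)) := by gcongr
      _ = η * k := by field_simp
  have hround : X = round X := by
    by_contra hne
    have hd : 0 < |X - round X| := abs_pos.2 (sub_ne_zero.2 hne)
    set d := |X - round X| with hdd
    obtain ⟨k, hk, hkX⟩ := hnear (min (1 / 2) (d / (4 * X))) (by positivity)
    have hk0 : (0 : ℝ) ≤ k := by positivity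
    have h1 : |X - k| ≤ 1 / 2 * k := hkX.trans (by gcongr; exact min_le_left _ _)
    have h2 : |X - k| ≤ d / (4 * X) * k := hkX.trans (by gcongr; exact min_le_right _ _)
    have h3 : (k : ℝ) ≤ 2 * X := by linarith [(abs_le.1 h1).1]
    have h4 : d ≤ |X - k| := by simpa using round_le X (k : ℤ)
    have h5 : d / (4 * X) * k ≤ d / (4 * X) * (2 * X) := by gcongr
    have h6 : d / (4 * X) * (2 * X) = d / 2 := by field_simp; ring
    linarith
  have hr0 : 0 < round X := by
    rw [hround] at hX0
    exact_mod_cast hX0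
  refine ⟨(round X).toNat, by omega, ?_⟩
  have h7 : (((round X).toNat : ℕ) : ℝ) = X := by
    rw [hround]
    have : (((round X).toNat : ℕ) : ℤ) = round X := Int.toNat_of_nonneg hr0.le
    simp only [round_intCast]
    exact_mod_cast this
  unfold bifurcationValue
  rw [h7, hX]
  field_simp
  linarith

/-! ### The local branch -/

theorem nat_eq_of_abs_sub_mul_le {k n : ℕ} (h : |(k : ℝ) - n| * (2 * k + 2) ≤ n) : n = k := by
  by_contra hne
  have h1 : (1 : ℝ) ≤ |(k : ℝ) - n| := by
    have h2 : (1 : ℤ) ≤ |(k : ℤ) - n| := Int.one_le_abs (by omega)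
    exact_mod_cast h2
  have h3 : (n : ℝ) ≤ k + |(k : ℝ) - n| := by linarith [neg_abs_le ((k : ℝ) - n)]
  have hk : (0 : ℝ) ≤ k := by positivity
  nlinarith

/-- The local branch through `λ_k` with its first two derivatives. Its points are nonconstant, so
`λ_k` is a bifurcation value. -/
theorem exists_localBranch {L M : ℝ} {k : ℕ} (hL : 0 < L) (hM : 0 < 1 - 3 * M ^ 2) (hk : 1 ≤ k) :
    (∃ (δ : ℝ) (Lam : ℝ → ℝ) (z : ℝ → ℝ → ℝ), IsLocalBranch L M k δ Lam z ∧ deriv Lam 0 = 0 ∧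
      deriv (deriv Lam) 0 = 2 * curvature M (bifurcationValue L M k)) ∧
    IsBifurcationPoint L M (bifurcationValue L M k) := by
  set lam₀ := bifurcationValue L M k with hlam₀
  have hk0 : (0 : ℝ) < k := by exact_mod_cast hk
  have hlam : 0 < lam₀ := by
    rw [hlam₀]; unfold bifurcationValue; positivity
  have hpos : 0 < lam₀ * (1 - 3 * M ^ 2) := mul_pos hlam hM
  set y₀ := lam₀ * (1 - 3 * M ^ 2) / 2 with hy₀'
  have hy : 0 < y₀ := half_pos hpos
  have hy₀ : y₀ < lam₀ * (1 - 3 * M ^ 2) := half_lt_self hpos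
  have hlen := length_eq_of_bifurcationValue hL hM hlam₀ hk
  obtain ⟨δ, hδ, γ, hγs, hγ0, hγ, N, hN, hNγ⟩ := exists_branch hy hL hy₀ hM hlen
  have h0mem : (0 : ℝ) ∈ Ioo (-δ) δ := ⟨by linarith, hδ⟩
  have hγc : ∀ s ∈ Ioo (-δ) δ, ContinuousAt γ s := fun s hs =>
    hγs.continuousOn.continuousAt (isOpen_Ioo.mem_nhds hs)
  have hρne : ∀ s ∈ Ioo (-δ) δ, s ≠ 0 → (γ s).2.2 ≠ 0 := by
    intro s hs hs0 hρ
    obtain ⟨-, h1, h2, h3⟩ := hγ s hs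
    rw [massDefect_eq hy, h1, hρ, zero_mul, add_zero] at h2
    have h4 : (γ s).2.1 - M = 0 := (mul_eq_zero.1 h2).resolve_right hL.ne'
    apply hs0
    rw [← h3]
    simp [amplitude, h4, hρ]
  have htend : Tendsto γ (𝓝[≠] 0) (𝓝 (lam₀, M, 0)) := by
    rw [← hγ0]
    exact (hγc 0 h0mem).tendsto.mono_left nhdsWithin_le_nhds
  have hmem : ∀ᶠ s in 𝓝[≠] (0 : ℝ), s ∈ Ioo (-δ) δ ∧ s ≠ 0 :=
    (eventually_nhdsWithin_of_eventually_nhds (isOpen_Ioo.eventually_mem h0mem)).and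
      self_mem_nhdsWithin
  have hev : ∀ᶠ s in 𝓝[≠] (0 : ℝ), position y₀ (γ s) (k * π) = L ∧ massDefect y₀ M k (γ s) = 0 ∧
      (γ s).2.2 ≠ 0 := hmem.mono fun s hs =>
    ⟨(hγ s hs.1).2.1, (hγ s hs.1).2.2.1, hρne s hs.1 hs.2⟩
  have hamp : Tendsto (fun s => (γ s).2.2 / s) (𝓝[≠] 0) (𝓝 1) := by
    have h := (tendsto_branch_amplitude hy hL hy₀ hlen htend hev).inv₀ one_ne_zero
    rw [inv_one] at h
    refine h.congr' ?_
    filter_upwards [hmem] with s hs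
    rw [(hγ s hs.1).2.2.2, inv_div]
  have hmean : Tendsto (fun s => ((γ s).2.1 - M) / s) (𝓝[≠] 0) (𝓝 0) := by
    have hρ0 : Tendsto (fun s => (γ s).2.2) (𝓝[≠] 0) (𝓝 0) :=
      ((continuous_snd.comp continuous_snd).tendsto _).comp htend
    have h := ((tendsto_branch_mean hy hL hy₀ hlen htend hev).mul hρ0).mul hamp
    rw [mul_zero, zero_mul] at h
    refine h.congr' ?_
    filter_upwards [hmem] with s hs
    have h1 := hρne s hs.1 hs.2
    have h2 := hs.2
    field_simp
  have hpar : Tendsto (fun s => ((γ s).1 - (γ 0).1) / s ^ 2) (𝓝[≠] 0) (𝓝 (curvature M lam₀)) := by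
    have h := (tendsto_branch_parameter hy hL hy₀ hM hlen htend hev).mul (hamp.pow 2)
    rw [one_pow, mul_one] at h
    refine h.congr' ?_
    filter_upwards [hmem] with s hs
    have h1 := hρne s hs.1 hs.2
    have h2 := hs.2
    rw [hγ0]
    field_simp
  -- Division by zero makes `n 0 = 0`, the continuous extension; `κ` needs its value at `0`.
  set n : ℝ → ℝ := fun s => ((γ s).2.1 - M) / s with hn
  set κ : ℝ → ℝ := fun s => if s = 0 then 1 else (γ s).2.2 / s with hκ
  have hnc : ∀ s ∈ Ioo (-δ) δ, ContinuousAt n s := by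
    intro s hs
    by_cases hs0 : s = 0
    · subst hs0
      rw [continuousAt_iff_punctured_nhds]
      simpa [hn] using hmean
    · have h1 := hγc s hs
      simp only [hn]
      fun_prop (disch := assumption)
  have hκc : ∀ s ∈ Ioo (-δ) δ, ContinuousAt κ s := by
    intro s hs
    by_cases hs0 : s = 0
    · subst hs0
      rw [continuousAt_iff_punctured_nhds]
      have : κ 0 = 1 := by simp [hκ]
      rw [this]
      refine hamp.congr' ?_
      filter_upwards [self_mem_nhdsWithin] with s hs
      simp only [hκ, if_neg (show s ≠ 0 from hs)]
    · have h1 := hγc s hs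
      have h2 : ContinuousAt (fun s => (γ s).2.2 / s) s := by fun_prop (disch := assumption)
      refine h2.congr ?_
      filter_upwards [isOpen_ne.mem_nhds hs0] with t ht
      simp only [hκ, if_neg ht]
  set z : ℝ → ℝ → ℝ := fun s x => (n s + κ s * cos (angle y₀ (γ s) x)) - cos (k * π * x / L) with hz
  have hbranch : ∀ s, branch L M k z s = profile y₀ (γ s) := by
    intro s
    funext x
    by_cases hs0 : s = 0
    · subst hs0
      simp [branch, profile, hγ0]
    · simp only [branch, hz, hn, hκ, profile, if_neg hs0]
      field_simp
      ring
  have hz0 : ∀ x, z 0 x = 0 := by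
    intro x
    have hpos0 : position y₀ (lam₀, M, 0) (k * π * x / L) = x := by
      have ha : √(lam₀ * (1 - 3 * M ^ 2)) ≠ 0 := (sqrt_pos.2 hpos).ne'
      have hkL : k * π = L * √(lam₀ * (1 - 3 * M ^ 2)) := by rw [← hlen]; field_simp
      rw [position_at_constant hy hy₀.le, hkL]
      field_simp
    have hang : angle y₀ (lam₀, M, 0) x = k * π * x / L := by
      conv_lhs => rw [← hpos0]
      exact angle_position hy _ _
    simp [hz, hn, hκ, hγ0, hang]
  have hC2W : ∀ s, ContDiff ℝ 2 fun x => n s + κ s * cos (angle y₀ (γ s) x) := fun s =>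
    contDiff_const.add (contDiff_const.mul (contDiff_cos_angle hy (γ s)))
  have hC2c : ContDiff ℝ 2 fun x : ℝ => cos (k * π * x / L) := by fun_prop
  have hint : ∀ s ∈ Ioo (-δ) δ, ∫ x in (0 : ℝ)..L, (profile y₀ (γ s) x - M) * cos (k * π * x / L)
      = L / 2 * s := fun s hs => by
    rw [integral_profile_mul_cos hy hL M (hγ s hs).2.1, (hγ s hs).2.2.2]
  have hcos2 : ∫ x in (0 : ℝ)..L, cos (k * π * x / L) ^ 2 = L / 2 := by
    have h := intervalIntegral.integral_comp_mul_left (a := 0) (b := L)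
      (fun t => cos t ^ 2) (c := k * π / L) (by positivity)
    rw [mul_zero, div_mul_cancel₀ _ hL.ne', integral_cos_sq_nat_mul_pi, smul_eq_mul] at h
    rw [show (fun x : ℝ => cos (k * π * x / L) ^ 2) = fun x => cos (k * π / L * x) ^ 2 from
      funext fun x => by rw [mul_div_right_comm], h]
    field_simp
  refine ⟨⟨δ, fun s => (γ s).1, z, ⟨hδ, contDiff_fst.comp_contDiffOn hγs, by rw [hγ0],
    fun x _ => hz0 x, ?_, ?_, ?_, ?_⟩, ?_⟩, ?_⟩
  · intro s₀ hs₀ η hη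
    filter_upwards [eventually_C2Close (L := L) hy (hnc s₀ hs₀) (hκc s₀ hs₀) (hγc s₀ hs₀) hη]
      with s hs
    exact hs.sub_right (hC2W s) (hC2W s₀) hC2c
  · intro s hs
    by_cases hs0 : s = 0
    · subst hs0
      simp [hz0]
    · have h1 : ∀ x, z s x * cos (k * π * x / L) = s⁻¹ *
          ((profile y₀ (γ s) x - M) * cos (k * π * x / L)) - cos (k * π * x / L) ^ 2 := by
        intro x
        rw [← hbranch s]
        simp only [branch]
        field_simp
        ring
      have hpc := (contDiff_profile hy (γ s)).continuous
      simp_rw [h1]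
      rw [intervalIntegral.integral_sub (Continuous.intervalIntegrable (by fun_prop) _ _)
        (Continuous.intervalIntegrable (by fun_prop) _ _), intervalIntegral.integral_const_mul,
        hint s hs, hcos2]
      field_simp
      ring
  · intro s hs
    rw [hbranch s]
    exact isClassicalSolution_profile hy hL (hγ s hs).1 (hγ s hs).2.1 (hγ s hs).2.2.1
  · set T := (√(lam₀ * (1 - 3 * M ^ 2)))⁻¹ with hT
    have hT0 : 0 < T := inv_pos.2 (sqrt_pos.2 hpos)
    obtain ⟨ε, hε, H⟩ := solution_near_constant hy hL hM hy₀ (inter_mem hN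
      (eventually_slowness_near (η := T / (2 * k + 2)) hy hy₀ (by positivity)))
    refine ⟨ε, hε, fun lam u h1 h2 h3 => ?_⟩
    by_cases hne : ∃ x ∈ Icc 0 L, u x ≠ M
    swap
    · push Not at hne
      exact Or.inl hne
    obtain ⟨p, ⟨hpN, hpT⟩, hp1, hpρ, hpu, j, hj, hjlen, hjmass⟩ := H lam u h1 h2 h3 hne
    -- The slowness is so close to its limit that the number of half-oscillations is fixed.
    have hjk : j = k := by
      have h5 := abs_position_sub_le hy (θ := j * π) (by positivity) hpT
      have h6 : L - j * π * T = (k - j) * (π * T) := by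
        rw [← hlen, hT]; ring
      rw [hjlen, h6, abs_mul, abs_of_pos (by positivity : 0 < π * T)] at h5
      refine nat_eq_of_abs_sub_mul_le ?_
      have h7 : T / (2 * k + 2) * (j * π) = j / (2 * k + 2) * (π * T) := by ring
      rw [h7] at h5
      rw [← le_div_iff₀ (by positivity)]
      exact le_of_mul_le_mul_right h5 (by positivity)
    subst hjk
    obtain ⟨hsI, hpγ⟩ := hNγ p hpN hjlen hjmass
    refine Or.inr ⟨_, hsI, ?_, ?_, ?_⟩
    · intro hs0
      rw [hs0, hγ0] at hpγ
      exact hpρ (by rw [hpγ])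
    · rw [← hp1]
      exact congrArg Prod.fst hpγ
    · rw [hbranch, ← hpγ]
      exact hpu
  · have h1 : ContDiffAt ℝ 2 (fun s => (γ s).1) 0 :=
      ((contDiff_fst.comp_contDiffOn hγs).contDiffAt (isOpen_Ioo.mem_nhds h0mem)).of_le
        (WithTop.coe_le_coe.2 le_top)
    exact second_derivative_of_tendsto_quotient h1 hpar
  · intro ε hε
    have hm : ContinuousAt (fun s => (γ s).2.1) 0 := by
      have := hγc 0 h0mem
      fun_prop
    have hρ : ContinuousAt (fun s => (γ s).2.2) 0 := by
      have := hγc 0 h0mem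
      fun_prop
    have hl : ContinuousAt (fun s => |(γ s).1 - lam₀|) 0 := by
      have := hγc 0 h0mem
      fun_prop
    have h1 := eventually_C2Close (L := L) hy hm hρ (hγc 0 h0mem) hε
    have h2 := hl.eventually_lt_const (u := ε) (by simpa [hγ0] using hε)
    obtain ⟨s, ⟨hs1, hs2⟩, hs3⟩ := (((h1.and h2).filter_mono nhdsWithin_le_nhds).and hmem).exists
    refine ⟨(γ s).1, profile y₀ (γ s), hs2,
      isClassicalSolution_profile hy hL (hγ s hs3.1).1 (hγ s hs3.1).2.1 (hγ s hs3.1).2.2.1,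
      ?_, ?_⟩
    · unfold profile
      simpa [hγ0] using hs1
    · by_contra hcon
      push Not at hcon
      have h3 := hint s hs3.1
      rw [intervalIntegral.integral_congr (g := fun _ => (0 : ℝ)) fun x hx => by
        rw [uIcc_of_le hL.le] at hx
        simp only [hcon x hx, sub_self, zero_mul]] at h3
      simp [hL.ne', hs3.2] at h3

/-! ### Absence of bifurcation when f' is nonpositive at the mean -/

/-- A one-dimensional Poincaré inequality, from expanding the square of `g - D / L`, where `D` is
the integral on the left. -/
theorem sq_integral_le {g : ℝ → ℝ} {L x y : ℝ} (hL : 0 < L) (hg : ContinuousOn g (Icc 0 L))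
    (hx : x ∈ Icc 0 L) (hy : y ∈ Icc 0 L) (hxy : x ≤ y) :
    (∫ t in x..y, g t) ^ 2 ≤ L * ∫ t in (0 : ℝ)..L, g t ^ 2 := by
  have hsub : Icc x y ⊆ Icc 0 L := Icc_subset_Icc hx.1 hy.2
  have hi : IntervalIntegrable g MeasureTheory.volume x y :=
    (hg.mono hsub).intervalIntegrable_of_Icc hxy
  have hi2 : IntervalIntegrable (fun t => g t ^ 2) MeasureTheory.volume x y :=
    ((hg.mono hsub).pow 2).intervalIntegrable_of_Icc hxy
  set D := ∫ t in x..y, g t with hD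
  have h1 : 0 ≤ ∫ t in x..y, (g t - D / L) ^ 2 :=
    intervalIntegral.integral_nonneg hxy fun t _ => sq_nonneg _
  have h2 : ∫ t in x..y, (g t - D / L) ^ 2
      = (∫ t in x..y, g t ^ 2) - 2 * (D / L) * D + (y - x) * (D / L) ^ 2 := by
    have h3 : ∀ t, (g t - D / L) ^ 2 = g t ^ 2 - 2 * (D / L) * g t + (D / L) ^ 2 := fun t => by ring
    simp_rw [h3]
    rw [intervalIntegral.integral_add (hi2.sub (hi.const_mul _)) intervalIntegrable_const,
      intervalIntegral.integral_sub hi2 (hi.const_mul _), intervalIntegral.integral_const_mul,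
      intervalIntegral.integral_const, smul_eq_mul]
  have h4 : ∫ t in x..y, g t ^ 2 ≤ ∫ t in (0 : ℝ)..L, g t ^ 2 :=
    intervalIntegral.integral_mono_interval hx.1 hxy hy.2
      (Eventually.of_forall fun t => sq_nonneg (g t))
      ((hg.pow 2).intervalIntegrable_of_Icc hL.le)
  have h5 : (y - x) * (D / L) ^ 2 ≤ L * (D / L) ^ 2 := by
    gcongr
    linarith [hx.1, hy.2]
  have h6 : 2 * (D / L) * D - L * (D / L) ^ 2 = D ^ 2 / L := by field_simp; ring
  have h7 : D ^ 2 / L ≤ ∫ t in (0 : ℝ)..L, g t ^ 2 := by linarith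
  rw [div_le_iff₀ hL] at h7
  linarith

theorem sq_le_two_mul_psi_mul {s : ℝ} (hs : |s| ≤ 1) : s ^ 2 ≤ 2 * (psi s * s) := by
  have h1 : √(1 + s ^ 2) ≤ 2 := by
    rw [sqrt_le_left (by norm_num)]
    have := (sq_le_one_iff_abs_le_one s).2 hs
    linarith
  have h0 : 0 < √(1 + s ^ 2) := sqrt_pos.2 (by positivity)
  unfold psi
  rw [div_mul_eq_mul_div, ← mul_div_assoc, le_div_iff₀ h0]
  nlinarith [sq_nonneg s]

theorem f_sub_mul_sub_le {M u ε : ℝ} (hM : 1 ≤ 3 * M ^ 2) (hu : |u - M| ≤ ε) :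
    (f u - f M) * (u - M) ≤ 3 * |M| * ε * (u - M) ^ 2 := by
  have h1 : (f u - f M) * (u - M)
      = ((1 - 3 * M ^ 2) - 3 * M * (u - M) - (u - M) ^ 2) * (u - M) ^ 2 := by
    unfold f; ring
  rw [h1]
  refine mul_le_mul_of_nonneg_right ?_ (sq_nonneg _)
  have h2 : -(M * (u - M)) ≤ |M| * ε :=
    (neg_le_abs _).trans (by rw [abs_mul]; gcongr)
  nlinarith [sq_nonneg (u - M)]

/-- Testing the equation with `u - M` gives `∫ u_x² ≤ C ε ∫ u_x²` for solutions `ε`-close to `M`,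
with `C` depending on `L`, `M`, `λ₀` only. The case `f'(M) = 0` is included. -/
theorem not_isBifurcationPoint {L M lam₀ : ℝ} (hL : 0 < L) (hM : 1 ≤ 3 * M ^ 2) (hlam : 0 < lam₀) :
    ¬ IsBifurcationPoint L M lam₀ := by
  intro hbif
  set Q := 12 * lam₀ * |M| * L ^ 2 with hQ
  have hQ0 : 0 ≤ Q := by positivity
  -- `ε ≤ λ₀` bounds `λ`, `ε ≤ 1` bounds `u_x`, and the last bound makes the constant small.
  set ε := min lam₀ (min 1 (1 / (2 * (Q + 1)))) with hε
  have hε0 : 0 < ε := by positivity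
  obtain ⟨lam, u, hl, hu, hclose, x₁, hx₁, hne⟩ := hbif ε hε0
  have hlam2 : 0 < lam ∧ lam < 2 * lam₀ := by
    have := abs_lt.1 (hl.trans_le (min_le_left _ _))
    constructor <;> linarith
  have hε1 : ε ≤ 1 := (min_le_right _ _).trans (min_le_left _ _)
  have hεQ : Q * ε ≤ 1 / 2 := by
    have h1 : ε ≤ 1 / (2 * (Q + 1)) := (min_le_right _ _).trans (min_le_right _ _)
    calc Q * ε ≤ Q * (1 / (2 * (Q + 1))) := by gcongr
      _ ≤ 1 / 2 := by
        rw [mul_one_div, div_le_div_iff₀ (by positivity) (by norm_num)]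
        linarith
  set c := lam / L * ∫ y in (0 : ℝ)..L, f (u y) with hc
  obtain ⟨hcont, hflux, -⟩ := phase_trajectory hL hu.contDiffOn_Ioo hu.contDiffOn_Icc hu.equation
  set g := derivWithin u (Icc 0 L) with hg
  have hcu : ContinuousOn u (Icc 0 L) := hu.contDiffOn_Icc.continuousOn
  have hcg : ContinuousOn g (Icc 0 L) := continuous_snd.comp_continuousOn hcont
  have hdu : ∀ x ∈ Ioo 0 L, HasDerivAt u (g x) x := fun x hx => by
    rw [hg, derivWithin_Icc_eq_deriv hx]
    exact ((hu.contDiffOn_Ioo.contDiffAt (isOpen_Ioo.mem_nhds hx)).differentiableAt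
      two_ne_zero).hasDerivAt
  have hux : ∀ x ∈ Icc 0 L, |u x - M| ≤ ε := fun x hx => hu.abs_sub_le hL hclose hx
  have hgx : ∀ x ∈ Ioo 0 L, |g x| ≤ 1 := fun x hx => by
    have h1 := (hclose x hx).2.1
    rw [deriv_const, sub_zero] at h1
    rw [hg, derivWithin_Icc_eq_deriv hx]
    exact h1.le.trans hε1
  set I := ∫ t in (0 : ℝ)..L, g t ^ 2 with hI
  have hosc : ∀ x ∈ Icc 0 L, ∀ y ∈ Icc 0 L, x ≤ y → |u y - u x| ≤ √(L * I) := by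
    intro x hx y hy hxy
    have hsub : Icc x y ⊆ Icc 0 L := Icc_subset_Icc hx.1 hy.2
    have h1 : ∫ t in x..y, g t = u y - u x :=
      intervalIntegral.integral_eq_sub_of_hasDerivAt_of_le hxy (hcu.mono hsub)
        (fun t ht => hdu t ⟨hx.1.trans_lt ht.1, ht.2.trans_le hy.2⟩)
        ((hcg.mono hsub).intervalIntegrable_of_Icc hxy)
    rw [← h1]
    exact abs_le_sqrt (sq_integral_le hL hcg hx hy hxy)
  have hI0 : 0 ≤ I := intervalIntegral.integral_nonneg hL.le fun t _ => sq_nonneg _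
  have hsup : ∀ x ∈ Icc 0 L, (u x - M) ^ 2 ≤ L * I := by
    intro x hx
    have h1 := abs_average_sub_le (η := √(L * I)) (y := u x) hL hcu fun y hy => by
      rcases le_total x y with h | h
      · exact hosc x hx y hy h
      · rw [abs_sub_comm]
        exact hosc y hy x hx h
    rw [hu.mass, abs_sub_comm] at h1
    rw [← sq_sqrt (by positivity : 0 ≤ L * I)]
    exact sq_le_sq' (by linarith [(abs_le.1 h1).1]) (abs_le.1 h1).2
  have hcfu : ContinuousOn (fun x => f (u x)) (Icc 0 L) := continuous_f.comp_continuousOn hcu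
  have hcpsi : ContinuousOn (fun x => psi (g x)) (Icc 0 L) := continuous_psi.comp_continuousOn hcg
  have hmass : ∫ x in (0 : ℝ)..L, (u x - M) = 0 :=
    (mass_eq_iff hL (hcu.intervalIntegrable_of_Icc hL.le)).1 hu.mass
  have hparts : ∫ x in (0 : ℝ)..L, ((c - lam * f (u x)) * (u x - M) + psi (g x) * g x) = 0 := by
    rw [intervalIntegral.integral_eq_sub_of_hasDerivAt_of_le hL.le
      (f := fun x => psi (g x) * (u x - M)) (hcpsi.mul (hcu.sub continuousOn_const))
      (fun x hx => (hflux x hx).mul ((hdu x hx).sub_const M))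
      (ContinuousOn.intervalIntegrable_of_Icc hL.le
        (((continuousOn_const.sub (continuousOn_const.mul hcfu)).mul
          (hcu.sub continuousOn_const)).add (hcpsi.mul hcg)))]
    rw [show g 0 = 0 from hu.neumann_left, show g L = 0 from hu.neumann_right]
    simp [psi]
  have hbound : ∀ x ∈ Icc 0 L, psi (g x) * g x + (c - lam * f (u x)) * (u x - M)
      ≥ g x ^ 2 / 2 - 6 * lam₀ * |M| * ε * (L * I) + (c - lam * f M) * (u x - M) := by
    intro x hx
    have hgx1 : |g x| ≤ 1 := by
      have hcl : closure (Ioo 0 L) = Icc 0 L := closure_Ioo hL.ne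
      refine le_on_closure (s := Ioo 0 L) (f := fun x => |g x|) (g := fun _ => (1 : ℝ))
        hgx ?_ continuousOn_const (by rwa [hcl])
      rw [hcl]
      exact hcg.abs
    have h1 := sq_le_two_mul_psi_mul hgx1
    have h2 := f_sub_mul_sub_le hM (hux x hx)
    have h3 : lam * ((f (u x) - f M) * (u x - M)) ≤ 2 * lam₀ * (3 * |M| * ε * (L * I)) := by
      calc lam * ((f (u x) - f M) * (u x - M)) ≤ lam * (3 * |M| * ε * (u x - M) ^ 2) := by
            gcongr
            exact hlam2.1.le
        _ ≤ lam * (3 * |M| * ε * (L * I)) := by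
            gcongr
            · exact hlam2.1.le
            · exact hsup x hx
        _ ≤ _ := by
            gcongr
            exact hlam2.2.le
    nlinarith
  have hmono := intervalIntegral.integral_mono_on (μ := MeasureTheory.volume) hL.le
    (f := fun x => g x ^ 2 / 2 - 6 * lam₀ * |M| * ε * (L * I) + (c - lam * f M) * (u x - M))
    (g := fun x => psi (g x) * g x + (c - lam * f (u x)) * (u x - M))
    (ContinuousOn.intervalIntegrable_of_Icc hL.le
      ((((hcg.pow 2).div_const 2).sub continuousOn_const).add
        (continuousOn_const.mul (hcu.sub continuousOn_const))))
    (ContinuousOn.intervalIntegrable_of_Icc hL.le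
      ((hcpsi.mul hcg).add ((continuousOn_const.sub (continuousOn_const.mul hcfu)).mul
        (hcu.sub continuousOn_const))))
    hbound
  have hg2 : IntervalIntegrable (fun x => g x ^ 2 / 2) MeasureTheory.volume 0 L :=
    ((hcg.pow 2).div_const 2).intervalIntegrable_of_Icc hL.le
  have huM : IntervalIntegrable (fun x => (c - lam * f M) * (u x - M)) MeasureTheory.volume 0 L :=
    (continuousOn_const.mul (hcu.sub continuousOn_const)).intervalIntegrable_of_Icc hL.le
  have hmass' : ∫ x in (0 : ℝ)..L, (c - lam * f M) * (u x - M) = 0 := by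
    rw [intervalIntegral.integral_const_mul, hmass, mul_zero]
  simp_rw [add_comm (psi _ * _)] at hmono
  rw [hparts, intervalIntegral.integral_add (hg2.sub intervalIntegrable_const) huM,
    intervalIntegral.integral_sub hg2 intervalIntegrable_const,
    hmass', intervalIntegral.integral_div,
    intervalIntegral.integral_const, smul_eq_mul, ← hI] at hmono
  have hfin : I / 2 ≤ I / 4 := by
    have h1 : (L - 0) * (6 * lam₀ * |M| * ε * (L * I)) = Q * ε * I / 2 := by
      rw [hQ]; ring
    rw [h1] at hmono
    nlinarith
  have hIz : I = 0 := by linarith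
  apply hne
  have h1 := hsup x₁ hx₁
  rw [hIz, mul_zero] at h1
  have h2 := pow_eq_zero_iff two_ne_zero |>.1 (le_antisymm h1 (sq_nonneg _))
  linarith

end MassConstrained

theorem proposition2 (L M : ℝ) (hL : 0 < L) :
    -- the bifurcation values in `(0,∞)` are exactly `λ₁ < λ₂ < ⋯`
    (|M| < 1 / √3 → ∀ lam₀ : ℝ, 0 < lam₀ →
      (MassConstrained.IsBifurcationPoint L M lam₀ ↔
        ∃ k : ℕ, 1 ≤ k ∧ lam₀ = MassConstrained.bifurcationValue L M k)) ∧
    (|M| < 1 / √5 → ∀ k : ℕ, 1 ≤ k →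
      (MassConstrained.criticalLength M k < L →
        MassConstrained.IsSupercriticalPitchfork L M k) ∧
      (L < MassConstrained.criticalLength M k →
        MassConstrained.IsSubcriticalPitchfork L M k)) ∧
    (1 / √5 < |M| → |M| < 1 / √3 → ∀ k : ℕ, 1 ≤ k →
      MassConstrained.IsSubcriticalPitchfork L M k) ∧
    (1 / √3 ≤ |M| → ∀ lam₀ : ℝ, 0 < lam₀ →
      ¬ MassConstrained.IsBifurcationPoint L M lam₀) := by
  open MassConstrained in
  have hcurv : ∀ k : ℕ, 1 ≤ k → 0 < 1 - 3 * M ^ 2 → ∃ A > 0,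
      2 * curvature M (bifurcationValue L M k) = A * ((1 - 5 * M ^ 2) / (1 - 3 * M ^ 2) ^ 2
        - (k * π / L) ^ 2 / 2) := by
    intro k hk hM
    have hk0 : (0 : ℝ) < k := by exact_mod_cast hk
    have hlam : 0 < bifurcationValue L M k := by
      unfold bifurcationValue; positivity
    have h1 : bifurcationValue L M k * (1 - 3 * M ^ 2) = (k * π / L) ^ 2 := by
      unfold bifurcationValue
      field_simp
    refine ⟨3 * bifurcationValue L M k / 2, by positivity, ?_⟩
    unfold curvature
    rw [h1]
    ring
  refine ⟨fun hM lam₀ hlam => ⟨MassConstrained.exists_bifurcationValue_eq hL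
    (MassConstrained.one_sub_three_sq_pos hM) hlam, ?_⟩, fun hM5 k hk => ?_, fun hM5 hM k hk => ?_,
    fun hM lam₀ hlam => MassConstrained.not_isBifurcationPoint hL ?_ hlam⟩
  · rintro ⟨k, hk, rfl⟩
    exact (MassConstrained.exists_localBranch hL (MassConstrained.one_sub_three_sq_pos hM) hk).2
  · have h5 : 0 < 1 - 5 * M ^ 2 := by
      have h : |M| ^ 2 < (1 / √5) ^ 2 := pow_lt_pow_left₀ hM5 (abs_nonneg _) two_ne_zero
      rw [sq_abs, div_pow, sq_sqrt (by norm_num)] at h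
      linarith
    have hM : 0 < 1 - 3 * M ^ 2 := by nlinarith [sq_nonneg M]
    have hk0 : (0 : ℝ) < k := by exact_mod_cast hk
    obtain ⟨⟨δ, Lam, z, hbr, hd1, hd2⟩, -⟩ := MassConstrained.exists_localBranch hL hM hk
    obtain ⟨A, hA, hcA⟩ := hcurv k hk hM
    set C := MassConstrained.criticalLength M k with hC
    have hC0 : 0 < C := by
      rw [hC]; unfold MassConstrained.criticalLength; positivity
    have hCsq : (1 - 5 * M ^ 2) / (1 - 3 * M ^ 2) ^ 2 = (k * π / C) ^ 2 / 2 := by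
      have h1 : C ^ 2 = (k * π) ^ 2 / 2 * ((1 - 3 * M ^ 2) ^ 2 / (1 - 5 * M ^ 2)) := by
        rw [hC]; unfold MassConstrained.criticalLength
        rw [mul_pow, div_pow, div_pow, sq_sqrt (by norm_num), sq_sqrt h5.le]
      rw [div_pow, h1]
      field_simp
    rw [hcA, hCsq] at hd2
    refine ⟨fun hlt => ⟨δ, Lam, z, hbr, hd1, ?_⟩, fun hlt => ⟨δ, Lam, z, hbr, hd1, ?_⟩⟩
    · rw [hd2]
      have h1 : (k * π / L) ^ 2 < (k * π / C) ^ 2 := by gcongr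
      exact mul_pos hA (by linarith)
    · rw [hd2]
      have h1 : (k * π / C) ^ 2 < (k * π / L) ^ 2 := by gcongr
      exact mul_neg_of_pos_of_neg hA (by linarith)
  · have h5 : 1 - 5 * M ^ 2 < 0 := by
      have h : (1 / √5) ^ 2 < |M| ^ 2 := pow_lt_pow_left₀ hM5 (by positivity) two_ne_zero
      rw [sq_abs, div_pow, sq_sqrt (by norm_num)] at h
      linarith
    have hM3 := MassConstrained.one_sub_three_sq_pos hM
    obtain ⟨⟨δ, Lam, z, hbr, hd1, hd2⟩, -⟩ := MassConstrained.exists_localBranch hL hM3 hk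
    obtain ⟨A, hA, hcA⟩ := hcurv k hk hM3
    refine ⟨δ, Lam, z, hbr, hd1, ?_⟩
    rw [hd2, hcA]
    have h1 : (1 - 5 * M ^ 2) / (1 - 3 * M ^ 2) ^ 2 < 0 := div_neg_of_neg_of_pos h5 (by positivity)
    exact mul_neg_of_pos_of_neg hA (by linarith [sq_nonneg (k * π / L)])
  · have h : (1 / √3) ^ 2 ≤ |M| ^ 2 := pow_le_pow_left₀ (by positivity) hM 2
    rw [sq_abs, div_pow, sq_sqrt (by norm_num)] at h
    linarith
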